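/- **Setting.** Let $\mathcal M$ be the space of boundedly finite Borel measures on $\mathbb R$ (measures giving finite mass to every bounded Borel set), with the $\sigma$-algebra generated by the maps $\mu\mapsto\mu(A)$, $A\subset\mathbb R$ Borel, and let $\mathcal M^*=\mathcal M\setminus\{0\}$. For $x\in\mathbb R$ let $(T_x\mu)(A)=\mu(A-x)$, and for a measure $\Delta$ on $\mathcal M^*$ let $T_x\Delta$ be its image under $T_x$. Write $\langle\mu,f\rangle=\int f\,d\mu$. For $\mu\in\mathcal M^*$ let $$M(\mu)=\inf\{x\in\mathbb R:\ \mu((x,\infty))<\min(1,\mu(\mathbb R)/2)\}\qquad(\inf\emptyset=+\infty).$$ A random measure $Z$ is a random variable with values in $\mathcal M$; its cumulant is $K(f)=-\log\mathbf E[\exp(-\langle Z,f\rangle)]\in[0,\infty]$ for measurable $f:\mathbb R\to[0,\infty)$. It is called superposable if for all $\alpha,\beta\in\mathbb R$ with $e^\alpha+e^\beta=1$, $Z$ is equal in law to $T_\alpha Z+T_\beta Z'$, where $Z'$ is an independent copy of $Z$. **Theorem.** Let $Z$ be a random measure on $\mathbb R$ with cumulant $K$. Then $Z$ is superposable if and only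 if there are a constant $c\ge 0$ and a measure $\Delta$ on $\mathcal M^*$ such that $$\int_{\mathbb R}e^x\int_0^\infty(1-e^{-y})\,\Delta(\mu(A+x)\in dy)\,dx<\infty\quad\text{for every bounded Borel set }A\subset\mathbb R,\tag{1}$$ and, for every measurable $f:\mathbb R\to[0,\infty)$, $$K(f)=c\int_{\mathbb R}e^{-x}f(x)\,dx+\int_{\mathbb R}e^{-x}\int_{\mathcal M^*}\bigl[1-\exp(-\langle\mu,f\rangle)\bigr]\,T_x\Delta(d\mu)\,dx.\tag{2}$$ Moreover, if $Z$ is superposable, then there is exactly one measure $\Delta$ on $\mathcal M^*$ with $\Delta(M(\mu)\neq0)=0$ that satisfies (1) and, for some constant $c\ge0$, (2). -/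

import Mathlib

open MeasureTheory ProbabilityTheory
open scoped ENNReal NNReal

noncomputable section

namespace RandomMeasure

/-- The space of boundedly finite measures on `ℝ`. Its sigma-algebra is the one generated by the
evaluations `μ ↦ μ A`, `A` Borel (this is the Borel sigma-algebra of the vague topology). -/
abbrev BFMeasure : Type :=
  {μ : Measure ℝ // ∀ A : Set ℝ, MeasurableSet A → Bornology.IsBounded A → μ A < ∞}

/-- The sum of two boundedly finite measures. -/
def BFMeasure.add (μ ν : BFMeasure) : BFMeasure :=
  ⟨μ.1 + ν.1, fun A hA hb => by
    rw [Measure.add_apply]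
    exact ENNReal.add_lt_top.2 ⟨μ.2 A hA hb, ν.2 A hA hb⟩⟩

/-- The translation `T_x`, that is `(T_x μ)(A) = μ(A - x)`. -/
def BFMeasure.translate (x : ℝ) (μ : BFMeasure) : BFMeasure :=
  ⟨μ.1.map (fun y => y + x), fun A hA hb => by
    have hm : Measurable (fun y : ℝ => y + x) := measurable_id.add_const x
    rw [Measure.map_apply hm hA]
    refine μ.2 _ (hm hA) ?_
    obtain ⟨r, hr⟩ := hb.exists_norm_le
    refine isBounded_iff_forall_norm_le.2 ⟨r + ‖x‖, fun y hy => ?_⟩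
    have h1 : ‖y + x‖ ≤ r := hr _ hy
    have h2 : ‖y‖ ≤ ‖y + x‖ + ‖x‖ := by simpa using norm_sub_le (y + x) x
    linarith⟩

/-- The space of nonzero boundedly finite measures on `ℝ`. -/
abbrev BFMeasureStar : Type := {μ : BFMeasure // μ.1 ≠ 0}

/-- The translation `T_x` on nonzero boundedly finite measures. -/
def BFMeasureStar.translate (x : ℝ) (μ : BFMeasureStar) : BFMeasureStar :=
  ⟨BFMeasure.translate x μ.1, fun h => μ.2
    ((Measure.map_eq_zero_iff (measurable_id.add_const x).aemeasurable).1 h)⟩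

/-- `M(μ) = inf {x ∈ ℝ : μ((x, ∞)) < min(1, μ(ℝ)/2)}`, computed in the extended reals. It is a
real number when `μ((0, ∞)) < ∞`; otherwise the set is empty and the value is `+∞`. -/
def rightPosition (μ : BFMeasureStar) : EReal :=
  sInf {r : EReal | ∃ x : ℝ, r = x ∧ μ.1.1 (Set.Ioi x) < min 1 (μ.1.1 Set.univ / 2)}

/-- `⟨μ, f⟩ = ∫ f dμ ∈ [0, ∞]`. -/
def pairing (μ : Measure ℝ) (f : ℝ → ℝ≥0) : ℝ≥0∞ := ∫⁻ x, f x ∂μ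

/-- `exp(-t)` for `t ∈ [0, ∞]`, with `exp(-∞) = 0`. -/
def expNeg (t : ℝ≥0∞) : ℝ≥0∞ := EReal.exp (-(t : EReal))

/-- The cumulant `K_Z(f) = -log E[exp(-⟨Z, f⟩)]`, with `-log 0 = ∞`. -/
def cumulant {Ω : Type*} [MeasurableSpace Ω] (P : Measure Ω) (Z : Ω → BFMeasure) (f : ℝ → ℝ≥0) :
    EReal :=
  -ENNReal.log (∫⁻ ω, expNeg (pairing (Z ω).1 f) ∂P)

/-- `Z` is equal in law to `T_α Z + T_β Z'` whenever `e^α + e^β = 1`, with `Z'` an independent copy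
of `Z`. The pair `(Z, Z')` is realized on the product of the probability space with itself. -/
def Superposable {Ω : Type*} [MeasurableSpace Ω] (P : Measure Ω) (Z : Ω → BFMeasure) : Prop :=
  ∀ α β : ℝ, Real.exp α + Real.exp β = 1 →
    IdentDistrib Z
      (fun ω : Ω × Ω => ((Z ω.1).translate α).add ((Z ω.2).translate β)) P (P.prod P)

/-- `∫ e^x ∫_0^∞ (1 - e^{-y}) Δ(μ(A + x) ∈ dy) dx < ∞` for every bounded Borel set `A`. -/
def IntegrabilityCondition (Δ : Measure BFMeasureStar) : Prop :=
  ∀ A : Set ℝ, MeasurableSet A → Bornology.IsBounded A →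
    ∫⁻ x : ℝ, ENNReal.ofReal (Real.exp x) *
      ∫⁻ y in Set.Ioi (0 : ℝ), ENNReal.ofReal (1 - Real.exp (-y))
        ∂(Δ.map fun μ => (μ.1.1 ((fun z => z + x) '' A)).toReal) < ∞

/-- The right-hand side
`c ∫ e^{-x} f(x) dx + ∫ e^{-x} ∫ [1 - exp(-⟨μ, f⟩)] (T_x Δ)(dμ) dx`. -/
def cumulantForm (c : ℝ≥0) (Δ : Measure BFMeasureStar) (f : ℝ → ℝ≥0) : ℝ≥0∞ :=
  c * (∫⁻ x : ℝ, ENNReal.ofReal (Real.exp (-x)) * f x) +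
    ∫⁻ x : ℝ, ENNReal.ofReal (Real.exp (-x)) *
      ∫⁻ μ, (1 - expNeg (pairing μ.1.1 f)) ∂(Δ.map (BFMeasureStar.translate x))

/-- The cumulant of `Z` is given by the pair `(c, Δ)`, for all measurable `f : ℝ → [0, ∞)`. -/
def HasCumulantForm {Ω : Type*} [MeasurableSpace Ω] (P : Measure Ω) (Z : Ω → BFMeasure)
    (c : ℝ≥0) (Δ : Measure BFMeasureStar) : Prop :=
  ∀ f : ℝ → ℝ≥0, Measurable f → cumulant P Z f = (cumulantForm c Δ f : EReal)

end RandomMeasure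

end

noncomputable section

namespace RandomMeasure

open Filter Topology

/-! ### The function `t ↦ exp (-t)` on `[0, ∞]` -/

/-! The cumulant of T_α Z is f ↦ K(f(· + α)), so superposability says K(f) = K(f(· + α)) + K(f(· +
β)) whenever e^α + e^β = 1. Applied to translates of f, this makes t ↦ K(f(· + log t)) additive on
(0, ∞). Its values lie in [0, ∞], so it is linear, and K(f(· + x)) = e^x K(f) (`logLap_shift`).
Conversely, the right-hand side of (2) has this scaling by a substitution in e^{-x} dx
(`cumulantForm_shift`), and the scaling gives superposability back.

The scaling makes Z infinitely divisible, T_{-log n} Z being an n-th root in law. Hence K(f) = ⟨l,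
f⟩ + ∫ (1 - e^{-⟨μ,f⟩}) Λ(dμ) (`exists_lkForm`), where l and Λ are unique (`lkForm_unique`).
Uniqueness transfers the scaling to T_x l = e^x l and T_x Λ = e^x Λ. The first forces l = c e^{-x}
dx. For the second, M(T_x μ) = M(μ) + x and M is finite Λ-almost everywhere, so Λ disintegrates
along translation orbits: if Δ is the part of Λ on {0 ≤ M < 1}, weighted by e^M and recentred at M =
0, then Λ = ∫ e^{-x} T_x Δ dx (`flow_unflow`). The same recipe recovers any Δ carried by {M = 0}
from its Λ (`unflow_flow`), whence uniqueness. Condition (1) follows from finiteness of K on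
indicators of bounded sets.

The Lévy–Khintchine form comes from increments. If ⟨Z, g⟩ is almost surely finite, K(f + g) - K(f)
is, in f, the Laplace functional of a finite measure σ_g (`exists_tilt`), a limit of n (1 -
e^{-⟨μ,g⟩}) ρ_n(dμ) with ρ_n the n-th root. Compactness is obtained by recording μ through the
numbers exp(-μ(a, b]), a and b rational, in a cube; the increment formula itself keeps the limit
from leaving the set of measures. Symmetry of second differences gives (1 - e^{-⟨μ,h⟩}) σ_g = (1 -
e^{-⟨μ,g⟩}) σ_h, so dividing by the weight yields one Λ on nonzero measures for all g
(`exists_levyMeasure`), while the atom of σ_g at the zero measure is the drift ⟨l, g⟩. -/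

lemma expNeg_eq_inv (t : ℝ≥0∞) : expNeg t = (EReal.exp t)⁻¹ := EReal.exp_neg _

lemma one_le_exp_coe (t : ℝ≥0∞) : 1 ≤ EReal.exp t :=
  EReal.one_le_exp_iff.2 (EReal.coe_ennreal_nonneg t)

@[simp] lemma expNeg_zero : expNeg 0 = 1 := by simp [expNeg]

@[simp] lemma expNeg_top : expNeg ∞ = 0 := by simp [expNeg]

lemma expNeg_add (s t : ℝ≥0∞) : expNeg (s + t) = expNeg s * expNeg t := by
  have h (t : ℝ≥0∞) : EReal.exp t ≠ 0 := (zero_lt_one.trans_le (one_le_exp_coe t)).ne'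
  rw [expNeg_eq_inv, expNeg_eq_inv, expNeg_eq_inv, EReal.coe_ennreal_add, EReal.exp_add,
    ENNReal.mul_inv (Or.inl (h s)) (Or.inr (h t))]

lemma expNeg_le_one (t : ℝ≥0∞) : expNeg t ≤ 1 := by
  rw [expNeg_eq_inv]; exact ENNReal.inv_le_one.2 (one_le_exp_coe t)

lemma expNeg_ne_top (t : ℝ≥0∞) : expNeg t ≠ ∞ := ne_top_of_le_ne_top ENNReal.one_ne_top (expNeg_le_one t)

lemma expNeg_le_expNeg {s t : ℝ≥0∞} : expNeg s ≤ expNeg t ↔ t ≤ s := by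
  simp [expNeg, EReal.exp_le_exp_iff, EReal.neg_le_neg_iff]

lemma antitone_expNeg : Antitone expNeg := fun _ _ h => expNeg_le_expNeg.2 h

lemma expNeg_injective : Function.Injective expNeg := fun _ _ h =>
  le_antisymm (expNeg_le_expNeg.1 h.ge) (expNeg_le_expNeg.1 h.le)

lemma expNeg_inj {s t : ℝ≥0∞} : expNeg s = expNeg t ↔ s = t := expNeg_injective.eq_iff

lemma expNeg_eq_zero {t : ℝ≥0∞} : expNeg t = 0 ↔ t = ∞ := by
  rw [← expNeg_top, expNeg_inj]

lemma continuous_expNeg : Continuous expNeg :=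
  ENNReal.continuous_exp.comp (continuous_neg.comp continuous_coe_ennreal_ereal)

@[fun_prop]
lemma measurable_expNeg : Measurable expNeg := continuous_expNeg.measurable

lemma expNeg_of_ne_top {t : ℝ≥0∞} (ht : t ≠ ∞) : expNeg t = ENNReal.ofReal (Real.exp (-t.toReal)) := by
  rw [expNeg, ← EReal.coe_ennreal_toReal ht, ← EReal.coe_neg, EReal.exp_coe]

lemma toReal_expNeg {t : ℝ≥0∞} (ht : t ≠ ∞) : (expNeg t).toReal = Real.exp (-t.toReal) := by
  rw [expNeg_of_ne_top ht, ENNReal.toReal_ofReal (Real.exp_pos _).le]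

lemma one_sub_expNeg_eq_zero {t : ℝ≥0∞} : 1 - expNeg t = 0 ↔ t = 0 := by
  rw [tsub_eq_zero_iff_le, ← expNeg_zero, expNeg_le_expNeg, nonpos_iff_eq_zero]

lemma expNeg_add_one_sub (t : ℝ≥0∞) : expNeg t + (1 - expNeg t) = 1 :=
  add_tsub_cancel_of_le (expNeg_le_one t)

lemma one_sub_expNeg_add (s t : ℝ≥0∞) :
    1 - expNeg (s + t) = (1 - expNeg s) + expNeg s * (1 - expNeg t) := by
  refine ENNReal.sub_eq_of_eq_add (expNeg_ne_top _) ?_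
  rw [expNeg_add, add_assoc, ← mul_add, add_comm (1 - expNeg t), expNeg_add_one_sub, mul_one,
    add_comm, expNeg_add_one_sub]

/-- The inverse `s ↦ -log s` of `expNeg` on `[0, 1]`. -/
def negLog (s : ℝ≥0∞) : ℝ≥0∞ := (-ENNReal.log s).toENNReal

lemma coe_negLog {s : ℝ≥0∞} (hs : s ≤ 1) : (negLog s : EReal) = -ENNReal.log s := by
  refine EReal.coe_toENNReal ?_
  rw [EReal.le_neg, neg_zero]
  exact ENNReal.log_le_zero_iff.2 hs

lemma expNeg_negLog {s : ℝ≥0∞} (hs : s ≤ 1) : expNeg (negLog s) = s := by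
  rw [expNeg, coe_negLog hs, neg_neg, ENNReal.exp_log]

lemma continuous_negLog : Continuous negLog :=
  EReal.continuous_toENNReal.comp (continuous_neg.comp ENNReal.continuous_log)

/-! ### Pairings and Laplace functionals -/

lemma pairing_add (μ : Measure ℝ) {f g : ℝ → ℝ≥0} (hf : Measurable f) :
    pairing μ (f + g) = pairing μ f + pairing μ g := by
  simp only [pairing, Pi.add_apply, ENNReal.coe_add]
  exact lintegral_add_left hf.coe_nnreal_ennreal _

@[simp] lemma pairing_zero (μ : Measure ℝ) : pairing μ 0 = 0 := by simp [pairing]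

@[simp] lemma pairing_zero_measure (f : ℝ → ℝ≥0) : pairing 0 f = 0 := by simp [pairing]

lemma pairing_const_mul (μ : Measure ℝ) {f : ℝ → ℝ≥0} (hf : Measurable f) (c : ℝ≥0) :
    pairing μ (fun x => c * f x) = c * pairing μ f := by
  simp only [pairing, ENNReal.coe_mul]
  exact lintegral_const_mul _ hf.coe_nnreal_ennreal

lemma pairing_mono {μ : Measure ℝ} {f g : ℝ → ℝ≥0} (h : f ≤ g) : pairing μ f ≤ pairing μ g :=
  lintegral_mono fun x => ENNReal.coe_le_coe.2 (h x)

lemma pairing_indicator (μ : Measure ℝ) {A : Set ℝ} (hA : MeasurableSet A) (c : ℝ≥0) :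
    pairing μ (A.indicator fun _ => c) = c * μ A := by
  have : ∀ x, ((A.indicator (fun _ => c) x : ℝ≥0) : ℝ≥0∞) = A.indicator (fun _ => (c : ℝ≥0∞)) x :=
    fun x => by by_cases hx : x ∈ A <;> simp [hx]
  simp only [pairing, this, lintegral_indicator_const hA]

lemma pairing_add_measure (μ ν : Measure ℝ) (f : ℝ → ℝ≥0) :
    pairing (μ + ν) f = pairing μ f + pairing ν f := lintegral_add_measure _ _ _

lemma pairing_translate (x : ℝ) (μ : BFMeasure) {f : ℝ → ℝ≥0} (hf : Measurable f) :
    pairing (μ.translate x).1 f = pairing μ.1 (fun y => f (y + x)) :=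
  lintegral_map hf.coe_nnreal_ennreal (measurable_id.add_const x)

@[fun_prop]
lemma measurable_pairing {f : ℝ → ℝ≥0} (hf : Measurable f) :
    Measurable fun μ : BFMeasure => pairing μ.1 f :=
  (Measure.measurable_lintegral hf.coe_nnreal_ennreal).comp measurable_subtype_coe

@[fun_prop]
lemma measurable_expNeg_pairing {f : ℝ → ℝ≥0} (hf : Measurable f) :
    Measurable fun μ : BFMeasure => expNeg (pairing μ.1 f) :=
  measurable_expNeg.comp (measurable_pairing hf)

lemma measurable_eval {A : Set ℝ} (hA : MeasurableSet A) :
    Measurable fun μ : BFMeasure => μ.1 A :=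
  (Measure.measurable_coe hA).comp measurable_subtype_coe

lemma tendsto_pairing_of_dominated {μ : Measure ℝ} {f : ℕ → ℝ → ℝ≥0} {f₀ g : ℝ → ℝ≥0}
    (hf : ∀ n, Measurable (f n)) (hle : ∀ n, f n ≤ g) (hg : pairing μ g ≠ ∞)
    (h : ∀ x, Tendsto (fun n => f n x) atTop (𝓝 (f₀ x))) :
    Tendsto (fun n => pairing μ (f n)) atTop (𝓝 (pairing μ f₀)) :=
  tendsto_lintegral_of_dominated_convergence (fun x => (g x : ℝ≥0∞))
    (fun n => (hf n).coe_nnreal_ennreal)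
    (fun n => Eventually.of_forall fun x => ENNReal.coe_le_coe.2 (hle n x)) hg
    (Eventually.of_forall fun x => ENNReal.tendsto_coe.2 (h x))

lemma tendsto_pairing_of_monotone {μ : Measure ℝ} {f : ℕ → ℝ → ℝ≥0} {f₀ : ℝ → ℝ≥0}
    (hf : ∀ n, Measurable (f n)) (hmono : Monotone f)
    (h : ∀ x, Tendsto (fun n => f n x) atTop (𝓝 (f₀ x))) :
    Tendsto (fun n => pairing μ (f n)) atTop (𝓝 (pairing μ f₀)) :=
  lintegral_tendsto_of_tendsto_of_monotone
    (fun n => (hf n).coe_nnreal_ennreal.aemeasurable)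
    (Eventually.of_forall fun x _ _ hmn => ENNReal.coe_le_coe.2 (hmono hmn x))
    (Eventually.of_forall fun x => ENNReal.tendsto_coe.2 (h x))

/-- The Laplace functional of a measure on the space of boundedly finite measures. -/
def lap (ρ : Measure BFMeasure) (f : ℝ → ℝ≥0) : ℝ≥0∞ := ∫⁻ μ, expNeg (pairing μ.1 f) ∂ρ

/-- The cumulant, as a `[0, ∞]`-valued functional. -/
def logLap (ρ : Measure BFMeasure) (f : ℝ → ℝ≥0) : ℝ≥0∞ := negLog (lap ρ f)

lemma lap_le_univ (ρ : Measure BFMeasure) (f : ℝ → ℝ≥0) : lap ρ f ≤ ρ Set.univ := by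
  calc lap ρ f ≤ ∫⁻ _, 1 ∂ρ := lintegral_mono fun μ => expNeg_le_one _
    _ = _ := by simp

lemma lap_zero (ρ : Measure BFMeasure) : lap ρ 0 = ρ Set.univ := by simp [lap]

lemma lap_ne_top (ρ : Measure BFMeasure) [IsFiniteMeasure ρ] (f : ℝ → ℝ≥0) : lap ρ f ≠ ∞ :=
  ne_top_of_le_ne_top (measure_ne_top ρ _) (lap_le_univ ρ f)

lemma tendsto_lap {ρ : Measure BFMeasure} [IsFiniteMeasure ρ] {f : ℕ → ℝ → ℝ≥0} {f₀ : ℝ → ℝ≥0}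
    (hf : ∀ n, Measurable (f n))
    (h : ∀ᵐ μ ∂ρ, Tendsto (fun n => pairing μ.1 (f n)) atTop (𝓝 (pairing μ.1 f₀))) :
    Tendsto (fun n => lap ρ (f n)) atTop (𝓝 (lap ρ f₀)) :=
  tendsto_lintegral_of_dominated_convergence (fun _ => 1)
    (fun n => measurable_expNeg_pairing (hf n))
    (fun n => Eventually.of_forall fun μ => expNeg_le_one _) (by simp)
    (h.mono fun μ hμ => (continuous_expNeg.tendsto _).comp hμ)

section Prob
variable (ρ : Measure BFMeasure) [IsProbabilityMeasure ρ]

lemma lap_le_one (f : ℝ → ℝ≥0) : lap ρ f ≤ 1 := (lap_le_univ ρ f).trans (by simp)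

lemma expNeg_logLap (f : ℝ → ℝ≥0) : expNeg (logLap ρ f) = lap ρ f := expNeg_negLog (lap_le_one ρ f)

lemma logLap_zero : logLap ρ 0 = 0 := by
  rw [← expNeg_inj, expNeg_logLap, lap_zero]; simp

lemma logLap_mono {f g : ℝ → ℝ≥0} (h : f ≤ g) : logLap ρ f ≤ logLap ρ g := by
  rw [← expNeg_le_expNeg, expNeg_logLap, expNeg_logLap]
  exact lintegral_mono fun μ => antitone_expNeg (pairing_mono h)

variable {ρ}

lemma logLap_ne_top {f : ℝ → ℝ≥0} (hf : Measurable f) (h : ∀ᵐ μ ∂ρ, pairing μ.1 f ≠ ∞) :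
    logLap ρ f ≠ ∞ := by
  rw [Ne, ← expNeg_eq_zero, expNeg_logLap, lap,
    lintegral_eq_zero_iff (measurable_expNeg_pairing hf)]
  intro h0
  have : ∀ᵐ μ ∂ρ, False := by
    filter_upwards [h0, h] with μ h1 h2
    exact h2 (expNeg_eq_zero.1 h1)
  simp [ae_iff] at this

lemma tendsto_logLap {f : ℕ → ℝ → ℝ≥0} {f₀ : ℝ → ℝ≥0} (hf : ∀ n, Measurable (f n))
    (h : ∀ᵐ μ ∂ρ, Tendsto (fun n => pairing μ.1 (f n)) atTop (𝓝 (pairing μ.1 f₀))) :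
    Tendsto (fun n => logLap ρ (f n)) atTop (𝓝 (logLap ρ f₀)) :=
  (continuous_negLog.tendsto _).comp (tendsto_lap hf h)

end Prob

lemma cumulant_eq_logLap {Ω : Type*} [MeasurableSpace Ω] (P : Measure Ω) [IsProbabilityMeasure P]
    {Z : Ω → BFMeasure} (hZ : Measurable Z) {f : ℝ → ℝ≥0} (hf : Measurable f) :
    cumulant P Z f = (logLap (P.map Z) f : EReal) := by
  have := Measure.isProbabilityMeasure_map (μ := P) hZ.aemeasurable
  rw [logLap, coe_negLog (lap_le_one _ _), lap,
    lintegral_map (measurable_expNeg_pairing hf) hZ, cumulant]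

/-! ### Coordinates on the space of boundedly finite measures -/

/-- The compact space in which a boundedly finite measure is recorded by its masses on intervals
with rational endpoints. -/
abbrev CoordSpace : Type := ℚ × ℚ → unitInterval

lemma BFMeasure.Ioc_ne_top (μ : BFMeasure) (a b : ℝ) : μ.1 (Set.Ioc a b) ≠ ∞ :=
  (μ.2 _ measurableSet_Ioc (Metric.isBounded_Ioc a b)).ne

/-- The coordinates `exp (-μ (a, b])` of a boundedly finite measure. -/
def coord (μ : BFMeasure) : CoordSpace := fun i =>
  ⟨Real.exp (-(μ.1 (Set.Ioc (i.1 : ℝ) i.2)).toReal), (Real.exp_pos _).le,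
    Real.exp_le_one_iff.2 (neg_nonpos.2 ENNReal.toReal_nonneg)⟩

lemma measurable_coord : Measurable coord :=
  measurable_pi_iff.2 fun _ =>
    (Real.measurable_exp.comp
      (measurable_eval measurableSet_Ioc).ennreal_toReal.neg).subtype_mk

lemma eval_eq_coord (μ : BFMeasure) (i : ℚ × ℚ) :
    μ.1 (Set.Ioc (i.1 : ℝ) i.2) = ENNReal.ofReal (-Real.log (coord μ i)) := by
  simp [coord, ENNReal.ofReal_toReal (μ.Ioc_ne_top _ _)]

/-- The masses of rational intervals determine, through the π-system of rational half-lines, each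
restriction to (-N, N] as a measurable family of finite measures; the supremum over N recovers every
evaluation. -/
lemma measurable_of_coord {α : Type*} [MeasurableSpace α] {κ : α → BFMeasure}
    (h : Measurable fun a => coord (κ a)) : Measurable κ := by
  have hI (i : ℚ × ℚ) : Measurable fun a => (κ a).1 (Set.Ioc (i.1 : ℝ) i.2) := by
    simp only [eval_eq_coord]
    have := measurable_subtype_coe.comp ((measurable_pi_apply i).comp h)
    exact (Real.measurable_log.comp this).neg.ennreal_ofReal
  have hN (N : ℕ) : Measurable fun a => (κ a).1.restrict (Set.Ioc (-(N : ℝ)) N) := by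
    have (a : α) : IsFiniteMeasure ((κ a).1.restrict (Set.Ioc (-(N : ℝ)) N)) :=
      ⟨by rw [Measure.restrict_apply_univ]; exact ((κ a).Ioc_ne_top _ _).lt_top⟩
    refine Measurable.measure_of_isPiSystem
      (BorelSpace.measurable_eq.trans Real.borel_eq_generateFrom_Iic_rat)
      Real.isPiSystem_Iic_rat ?_ ?_
    · intro s hs
      obtain ⟨q, rfl⟩ := by simpa using hs
      have he : Set.Iic (q : ℝ) ∩ Set.Ioc (-(N : ℝ)) N
          = Set.Ioc (((-N : ℚ) : ℚ) : ℝ) ((min q N : ℚ) : ℝ) := by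
        ext x; simp; tauto
      simp only [Measure.restrict_apply measurableSet_Iic, he]
      exact hI (-N, min q N)
    · simpa using hI (-N, N)
  refine Measurable.subtype_mk (f := fun a => (κ a).1) ?_
  refine Measure.measurable_of_measurable_coe _ fun A hA => ?_
  have hsup (a : α) : (κ a).1 A = ⨆ N : ℕ, (κ a).1.restrict (Set.Ioc (-(N : ℝ)) N) A := by
    have hU : A = ⋃ N : ℕ, A ∩ Set.Ioc (-(N : ℝ)) N := by
      rw [← Set.inter_iUnion, eq_comm, Set.inter_eq_left]
      intro x _
      obtain ⟨N, hN⟩ := exists_nat_gt |x|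
      exact Set.mem_iUnion.2 ⟨N, (abs_lt.1 hN).1, (abs_lt.1 hN).2.le⟩
    conv_lhs => rw [hU]
    rw [Monotone.measure_iUnion]
    · simp only [Measure.restrict_apply hA]
    · intro m n hmn
      have : (m : ℝ) ≤ n := by exact_mod_cast hmn
      exact Set.inter_subset_inter_right _ (Set.Ioc_subset_Ioc (neg_le_neg this) this)
  simp only [hsup]
  exact .iSup fun N => (Measure.measurable_coe hA).comp (hN N)

/-- This is `measurable_of_coord` for the identity map, the source carrying the sigma-algebra pulled
back along `coord`. -/
lemma measurableSpace_le_comap_coord :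
    (inferInstance : MeasurableSpace BFMeasure) ≤ MeasurableSpace.comap coord inferInstance := by
  have : @Measurable _ _ (MeasurableSpace.comap coord inferInstance) _ (id : BFMeasure → BFMeasure) :=
    @measurable_of_coord _ (MeasurableSpace.comap coord inferInstance) _ (comap_measurable coord)
  exact fun s hs => this hs

/-- The set of ν with ν A = μ A is a preimage under `coord`, so it cannot separate measures with
equal coordinates. -/
lemma coord_injective : Function.Injective coord := by
  intro μ ν h
  refine Subtype.ext (Measure.ext fun A hA => ?_)
  obtain ⟨T, -, hT⟩ := measurableSpace_le_comap_coord _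
    (measurable_eval hA (measurableSet_singleton (μ.1 A)))
  have : ν ∈ coord ⁻¹' T := by
    rw [Set.mem_preimage, ← h, ← Set.mem_preimage, hT]; rfl
  rw [hT] at this
  exact (Set.mem_singleton_iff.1 this).symm

/-- Extend F by infima over rationals to the right. Passing to right limits could change the values
at rationals; `hr`, right continuity along the rationals, excludes this. -/
lemma exists_stieltjesFunction_eq_of_rat {F : ℚ → ℝ} (hF : Monotone F)
    (hr : ∀ q, ∀ ε > 0, ∃ n : ℕ, F (q + 1 / (n + 1)) < F q + ε) :
    ∃ G : StieltjesFunction ℝ, ∀ q : ℚ, G q = F q := by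
  let f : ℝ → ℝ := fun x => ⨅ r : {r : ℚ // x ≤ r}, F r
  have hne (x : ℝ) : Nonempty {r : ℚ // x ≤ r} :=
    let ⟨q, hq⟩ := exists_rat_gt x; ⟨⟨q, hq.le⟩⟩
  have hbdd (x : ℝ) : BddBelow (Set.range fun r : {r : ℚ // x ≤ r} => F r) := by
    obtain ⟨q, hq⟩ := exists_rat_lt x
    refine ⟨F q, ?_⟩
    rintro _ ⟨r, rfl⟩
    exact hF (by exact_mod_cast hq.le.trans r.2)
  have hf : Monotone f := fun x y hxy =>
    le_ciInf fun r => ciInf_le (hbdd x) ⟨r.1, hxy.trans r.2⟩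
  have hfq (q : ℚ) : f q = F q :=
    le_antisymm (ciInf_le (hbdd q) ⟨q, le_rfl⟩) (le_ciInf fun r => hF (by exact_mod_cast r.2))
  refine ⟨hf.stieltjesFunction, fun q => ?_⟩
  rw [hf.stieltjesFunction_eq]
  refine le_antisymm (le_of_forall_pos_lt_add fun ε hε => ?_) ?_
  · obtain ⟨n, hn⟩ := hr q ε hε
    refine lt_of_le_of_lt ?_ hn
    rw [← hfq (q + 1 / (n + 1))]
    refine hf.rightLim_le ?_
    have : (0 : ℚ) < 1 / (n + 1) := by positivity
    exact_mod_cast lt_add_of_pos_right q this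
  · rw [← hfq]
    exact hf.le_rightLim le_rfl

/-- The coordinates coming from a boundedly finite measure. -/
def goodCoord : Set CoordSpace :=
  {u | (∀ i, 0 < (u i : ℝ)) ∧ (∀ a b, b ≤ a → (u (a, b) : ℝ) = 1) ∧
    (∀ a b c, a ≤ b → b ≤ c → (u (a, c) : ℝ) = u (a, b) * u (b, c)) ∧
    ∀ (a : ℚ) (k : ℕ), ∃ n : ℕ, 1 - 1 / ((k : ℝ) + 1) < u (a, a + 1 / ((n : ℚ) + 1))}

lemma measurableSet_goodCoord : MeasurableSet goodCoord := by
  have hu (i : ℚ × ℚ) : Measurable fun u : CoordSpace => (u i : ℝ) :=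
    measurable_subtype_coe.comp (measurable_pi_apply i)
  refine measurableSet_setOfPred.2 (.and (.forall fun i => ?_) (.and (.forall fun a => .forall fun b =>
    .forall fun _ => ?_) (.and (.forall fun a => .forall fun b => .forall fun c => .forall fun _ =>
    .forall fun _ => ?_) (.forall fun a => .forall fun k => .exists fun n => ?_))))
  · exact measurableSet_setOfPred.1 (measurableSet_lt measurable_const (hu i))
  · exact measurableSet_setOfPred.1 (measurableSet_eq_fun (hu _) measurable_const)
  · exact measurableSet_setOfPred.1 (measurableSet_eq_fun (hu _) ((hu _).mul (hu _)))
  · exact measurableSet_setOfPred.1 (measurableSet_lt measurable_const (hu _))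

lemma coord_mem_goodCoord (μ : BFMeasure) : coord μ ∈ goodCoord := by
  refine ⟨fun i => Real.exp_pos _, fun a b h => ?_, fun a b c hab hbc => ?_, fun a k => ?_⟩
  · have : Set.Ioc (a : ℝ) b = ∅ := Set.Ioc_eq_empty (by simpa using h)
    simp [coord, this]
  · have hab' : (a : ℝ) ≤ b := by exact_mod_cast hab
    have hbc' : (b : ℝ) ≤ c := by exact_mod_cast hbc
    simp only [coord]
    rw [← Set.Ioc_union_Ioc_eq_Ioc hab' hbc',
      measure_union (Set.Ioc_disjoint_Ioc_of_le le_rfl) measurableSet_Ioc,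
      ENNReal.toReal_add (μ.Ioc_ne_top _ _) (μ.Ioc_ne_top _ _), neg_add, Real.exp_add]
  · have hlim : Tendsto (fun n : ℕ => μ.1 (Set.Ioc (a : ℝ) ((a + 1 / ((n : ℚ) + 1) : ℚ) : ℝ)))
        atTop (𝓝 0) := by
      have hempty : ⋂ n : ℕ, Set.Ioc (a : ℝ) ((a + 1 / ((n : ℚ) + 1) : ℚ) : ℝ) = ∅ := by
        refine Set.eq_empty_of_forall_notMem fun x hx => ?_
        have hx' := Set.mem_iInter.1 hx
        obtain ⟨n, hn⟩ := exists_nat_one_div_lt (sub_pos.2 (hx' 0).1)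
        have := (hx' n).2
        push_cast at this
        linarith
      rw [← measure_empty (μ := μ.1), ← hempty]
      refine tendsto_measure_iInter_atTop (fun n => measurableSet_Ioc.nullMeasurableSet) ?_
        ⟨0, μ.Ioc_ne_top _ _⟩
      intro m n hmn
      refine Set.Ioc_subset_Ioc le_rfl ?_
      have h : (m : ℚ) ≤ n := by exact_mod_cast hmn
      have : a + 1 / ((n : ℚ) + 1) ≤ a + 1 / ((m : ℚ) + 1) := by gcongr
      exact_mod_cast this
    have hlim' := (Real.continuous_exp.tendsto _).comp
      ((ENNReal.tendsto_toReal ENNReal.zero_ne_top).comp hlim).neg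
    simp only [ENNReal.toReal_zero, neg_zero, Real.exp_zero] at hlim'
    have hk : 1 - 1 / ((k : ℝ) + 1) < 1 := sub_lt_self _ (by positivity)
    exact (hlim'.eventually (lt_mem_nhds hk)).exists

/-- Positivity makes -log u finite, multiplicativity makes it an additive interval function, and the
last condition of `goodCoord` is right continuity, so -log u comes from a Stieltjes function. -/
lemma exists_coord_eq {u : CoordSpace} (hu : u ∈ goodCoord) : ∃ μ, coord μ = u := by
  obtain ⟨hpos, hone, hmul, hlim⟩ := hu
  -- The distribution function normalized by F 0 = 0: for each sign of q one of the two logarithms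
  -- vanishes.
  let F : ℚ → ℝ := fun q => Real.log (u (q, 0)) - Real.log (u (0, q))
  have hF {a b : ℚ} (hab : a ≤ b) : F b - F a = -Real.log (u (a, b)) := by
    have hlog {a b c : ℚ} (hab : a ≤ b) (hbc : b ≤ c) :
        Real.log (u (a, c)) = Real.log (u (a, b)) + Real.log (u (b, c)) := by
      rw [hmul a b c hab hbc, Real.log_mul (hpos _).ne' (hpos _).ne']
    have hl1 {a b : ℚ} (h : b ≤ a) : Real.log (u (a, b)) = 0 := by rw [hone a b h, Real.log_one]
    simp only [F]
    rcases le_total 0 a with h0 | h0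
    · rw [hl1 h0, hl1 (h0.trans hab), hlog h0 hab]; ring
    · rcases le_total 0 b with h1 | h1
      · rw [hl1 h0, hl1 h1, hlog h0 h1]; ring
      · rw [hl1 h0, hl1 h1, hlog hab h1]; ring
  have hmono : Monotone F := fun a b hab => by
    have := hF hab
    have := Real.log_nonpos (u (a, b)).2.1 (u (a, b)).2.2
    linarith
  obtain ⟨G, hG⟩ := exists_stieltjesFunction_eq_of_rat hmono (by
    intro q ε hε
    obtain ⟨k, hk⟩ := exists_nat_one_div_lt (sub_pos.2 (Real.exp_lt_one_iff.2 (neg_lt_zero.2 hε)))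
    obtain ⟨n, hn⟩ := hlim q k
    refine ⟨n, ?_⟩
    have h1 := hF (le_add_of_nonneg_right (by positivity : (0 : ℚ) ≤ 1 / (n + 1)) : q ≤ _)
    have h2 : Real.exp (-ε) < u (q, q + 1 / ((n : ℚ) + 1)) := by linarith
    have h3 := (Real.lt_log_iff_exp_lt (hpos _)).2 h2
    linarith)
  refine ⟨⟨G.measure, fun A _ hb => hb.measure_lt_top⟩, funext fun ⟨a, b⟩ => Subtype.ext ?_⟩
  simp only [coord, StieltjesFunction.measure_Ioc, hG]
  rcases le_total b a with h | h
  · rw [hone a b h, ENNReal.ofReal_of_nonpos (sub_nonpos.2 (hmono h))]; simp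
  · rw [ENNReal.toReal_ofReal (sub_nonneg.2 (hmono h)), hF h, neg_neg, Real.exp_log (hpos _)]

lemma range_coord : Set.range coord = goodCoord :=
  Set.Subset.antisymm (Set.range_subset_iff.2 coord_mem_goodCoord) fun _ => exists_coord_eq

/-- Laws on the space of measures can thus be pushed to a compact metrizable space and pulled back,
without using any topology on the space of measures. -/
lemma measurableEmbedding_coord : MeasurableEmbedding coord where
  injective := coord_injective
  measurable := measurable_coord
  measurableSet_image' := by
    intro s hs
    obtain ⟨T, hT, rfl⟩ := measurableSpace_le_comap_coord _ hs
    rw [Set.image_preimage_eq_inter_range, range_coord]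
    exact hT.inter measurableSet_goodCoord

/-! ### Test functions on the coordinate space -/

open BoundedContinuousFunction in
/-- The bounded continuous function `φ` of the coordinates represents `μ ↦ exp (-⟨μ, f⟩)`. -/
structure IsRep (φ : CoordSpace →ᵇ ℝ) (f : ℝ → ℝ≥0) : Prop where
  measurable : Measurable f
  ne_top : ∀ μ : BFMeasure, pairing μ.1 f ≠ ∞
  eq : ∀ μ : BFMeasure, φ (coord μ) = (expNeg (pairing μ.1 f)).toReal

lemma IsRep.one : IsRep 1 0 where
  measurable := measurable_const
  ne_top μ := by simp
  eq μ := by simp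

lemma IsRep.mul {φ ψ : BoundedContinuousFunction CoordSpace ℝ} {f g : ℝ → ℝ≥0} (hf : IsRep φ f)
    (hg : IsRep ψ g) : IsRep (φ * ψ) (f + g) where
  measurable := hf.measurable.add hg.measurable
  ne_top μ := by
    rw [pairing_add _ hf.measurable]
    exact ENNReal.add_ne_top.2 ⟨hf.ne_top μ, hg.ne_top μ⟩
  eq μ := by
    rw [pairing_add _ hf.measurable, expNeg_add, ENNReal.toReal_mul, ← hf.eq, ← hg.eq]; rfl

/-- The function `u ↦ (u i) ^ t` on the coordinate space. -/
def coordPow (i : ℚ × ℚ) (t : ℝ≥0) : BoundedContinuousFunction CoordSpace ℝ :=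
  BoundedContinuousFunction.mkOfCompact ⟨fun u => (u i : ℝ) ^ (t : ℝ),
    (Real.continuous_rpow_const t.2).comp (continuous_subtype_val.comp (continuous_apply i))⟩

lemma coordPow_apply (i : ℚ × ℚ) (t : ℝ≥0) (u : CoordSpace) :
    coordPow i t u = (u i : ℝ) ^ (t : ℝ) := rfl

lemma coordPow_one (i : ℚ × ℚ) (u : CoordSpace) : coordPow i 1 u = u i := by
  simp [coordPow_apply]

/-- Arbitrary real exponents are needed later: letting t tend to 0 detects whether a coordinate
vanishes. -/
lemma IsRep.coordPow (i : ℚ × ℚ) (t : ℝ≥0) :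
    IsRep (coordPow i t) ((Set.Ioc (i.1 : ℝ) i.2).indicator fun _ => t) where
  measurable := measurable_const.indicator measurableSet_Ioc
  ne_top μ := by
    rw [pairing_indicator _ measurableSet_Ioc]
    exact ENNReal.mul_ne_top ENNReal.coe_ne_top (μ.Ioc_ne_top _ _)
  eq μ := by
    have h := ENNReal.mul_ne_top (a := (t : ℝ≥0∞)) ENNReal.coe_ne_top (μ.Ioc_ne_top i.1 i.2)
    rw [pairing_indicator _ measurableSet_Ioc, toReal_expNeg h, coordPow_apply, coord,
      ← Real.exp_mul, ENNReal.toReal_mul, ENNReal.coe_toReal, neg_mul, mul_comm]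

lemma IsRep.integral_map_coord {φ : BoundedContinuousFunction CoordSpace ℝ} {f : ℝ → ℝ≥0}
    (hf : IsRep φ f) (ρ : Measure BFMeasure) : ∫ u, φ u ∂(ρ.map coord) = (lap ρ f).toReal := by
  rw [integral_map measurable_coord.aemeasurable φ.continuous.aestronglyMeasurable, lap,
    ← integral_toReal (measurable_expNeg_pairing hf.measurable).aemeasurable
      (Eventually.of_forall fun μ => (expNeg_ne_top _).lt_top)]
  simp only [hf.eq]

/-- The functions on the coordinate space that represent exponentials of pairings. -/
def repSubmonoid : Submonoid (BoundedContinuousFunction CoordSpace ℝ) where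
  carrier := {φ | ∃ f, IsRep φ f}
  one_mem' := ⟨0, .one⟩
  mul_mem' := fun ⟨f, hf⟩ ⟨g, hg⟩ => ⟨f + g, hf.mul hg⟩

/-- The algebra spanned by the functions that represent exponentials of pairings. -/
def repSubalgebra : StarSubalgebra ℝ (BoundedContinuousFunction CoordSpace ℝ) where
  toSubalgebra := Algebra.adjoin ℝ repSubmonoid
  star_mem' := fun {φ} hφ => by
    have : star φ = φ := by ext; simp
    rwa [this]

/-- A finite measure on the space of boundedly finite measures is determined by its Laplace
functional. -/
theorem ext_of_lap {ρ σ : Measure BFMeasure} [IsFiniteMeasure ρ] [IsFiniteMeasure σ]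
    (h : ∀ φ f, IsRep φ f → lap ρ f = lap σ f) : ρ = σ := by
  let _ : MetricSpace CoordSpace := TopologicalSpace.metrizableSpaceMetric CoordSpace
  rw [← measurableEmbedding_coord.comap_map ρ, ← measurableEmbedding_coord.comap_map σ]
  congr 1
  refine ext_of_forall_mem_subalgebra_integral_eq_of_pseudoEMetric_complete_countable (𝕜 := ℝ)
    (A := repSubalgebra) ?_ ?_
  · intro u v huv
    obtain ⟨i, hi⟩ := Function.ne_iff.1 huv
    refine ⟨coordPow i 1, ⟨_, ⟨coordPow i 1, ?_, rfl⟩, rfl⟩, ?_⟩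
    · exact Algebra.subset_adjoin ⟨_, IsRep.coordPow i 1⟩
    · simpa only [coordPow_one] using fun h => hi (Subtype.ext h)
  · intro φ hφ
    -- The representing functions are closed under multiplication, so the algebra they generate is
    -- their linear span and linearity reduces everything to single exponentials.
    have hφ' : φ ∈ Submodule.span ℝ (repSubmonoid : Set _) := by
      have := Algebra.adjoin_eq_span ℝ (repSubmonoid : Set (BoundedContinuousFunction CoordSpace ℝ))
      rw [Submonoid.closure_eq] at this
      rw [← this]
      exact hφ
    clear hφ
    have hi (φ : BoundedContinuousFunction CoordSpace ℝ) (ρ : Measure BFMeasure)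
      [IsFiniteMeasure ρ] : Integrable φ (ρ.map coord) := φ.integrable _
    induction hφ' using Submodule.span_induction with
    | mem φ hφ =>
      obtain ⟨f, hf⟩ := hφ
      rw [hf.integral_map_coord, hf.integral_map_coord, h φ f hf]
    | zero => simp
    | add φ ψ _ _ ih1 ih2 =>
      simp only [BoundedContinuousFunction.coe_add, Pi.add_apply]
      rw [integral_add (hi φ ρ) (hi ψ ρ), integral_add (hi φ σ) (hi ψ σ), ih1, ih2]
    | smul c φ _ ih => simp only [BoundedContinuousFunction.coe_smul, integral_smul, ih]

/-! ### Convolution of measures on the space of boundedly finite measures -/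

lemma measurable_add : Measurable fun p : BFMeasure × BFMeasure => p.1.add p.2 := by
  refine Measurable.subtype_mk (f := fun p : BFMeasure × BFMeasure => p.1.1 + p.2.1) ?_
  refine Measure.measurable_of_measurable_coe _ fun A hA => ?_
  simp only [Measure.add_apply]
  exact ((measurable_eval hA).comp measurable_fst).add ((measurable_eval hA).comp measurable_snd)

/-- The law of the sum of two independent random measures with given laws. -/
def conv (ρ σ : Measure BFMeasure) : Measure BFMeasure := (ρ.prod σ).map fun p => p.1.add p.2

lemma lap_conv (ρ σ : Measure BFMeasure) [SFinite σ] {f : ℝ → ℝ≥0} (hf : Measurable f) :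
    lap (conv ρ σ) f = lap ρ f * lap σ f := by
  rw [lap, conv, lintegral_map (measurable_expNeg_pairing hf) measurable_add]
  simp only [BFMeasure.add, pairing_add_measure, expNeg_add]
  exact lintegral_prod_mul (measurable_expNeg_pairing hf).aemeasurable
    (measurable_expNeg_pairing hf).aemeasurable

instance (ρ σ : Measure BFMeasure) [IsFiniteMeasure ρ] [IsFiniteMeasure σ] :
    IsFiniteMeasure (conv ρ σ) := by unfold conv; infer_instance

/-- The zero measure, as a boundedly finite measure. -/
def BFMeasure.zero : BFMeasure := ⟨0, by simp⟩

/-- Convolution powers. -/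
def convPow (ρ : Measure BFMeasure) : ℕ → Measure BFMeasure
  | 0 => Measure.dirac BFMeasure.zero
  | k + 1 => conv (convPow ρ k) ρ

lemma lap_convPow (ρ : Measure BFMeasure) [SFinite ρ] {f : ℝ → ℝ≥0} (hf : Measurable f) (k : ℕ) :
    lap (convPow ρ k) f = lap ρ f ^ k := by
  induction k with
  | zero =>
    rw [convPow, lap, lintegral_dirac' _ (measurable_expNeg_pairing hf), BFMeasure.zero]
    simp
  | succ k ih => rw [convPow, lap_conv _ _ hf, ih, pow_succ]

/-- The convolution exponential of a measure. -/
def convExp (ρ : Measure BFMeasure) : Measure BFMeasure :=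
  Measure.sum fun k : ℕ => (k.factorial : ℝ≥0∞)⁻¹ • convPow ρ k

lemma expNeg_mul_tsum {x : ℝ≥0∞} (hx : x ≠ ∞) :
    expNeg x * ∑' k : ℕ, (k.factorial : ℝ≥0∞)⁻¹ * x ^ k = 1 := by
  lift x to ℝ≥0 using hx
  have h (k : ℕ) : (k.factorial : ℝ≥0∞)⁻¹ * (x : ℝ≥0∞) ^ k
      = ENNReal.ofReal ((x : ℝ) ^ k / k.factorial) := by
    rw [ENNReal.ofReal_div_of_pos (by positivity), ENNReal.ofReal_pow x.coe_nonneg, ENNReal.ofReal_coe_nnreal,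
      ENNReal.ofReal_natCast, mul_comm, div_eq_mul_inv]
  simp only [h]
  rw [← ENNReal.ofReal_tsum_of_nonneg (fun k => by positivity) (Real.summable_pow_div_factorial x),
    expNeg_of_ne_top ENNReal.coe_ne_top, ← ENNReal.ofReal_mul (Real.exp_pos _).le]
  have := congrFun (NormedSpace.exp_eq_tsum_div (𝔸 := ℝ)) (x : ℝ)
  rw [← Real.exp_eq_exp_ℝ] at this
  rw [← this, ENNReal.coe_toReal, ← Real.exp_add]
  simp

/-- Convolution powers have the powers of `lap ρ f` as Laplace functionals, so the exponential
series gives e^{lap ρ f}. The product form avoids an exponential with values in [0, ∞]. -/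
lemma expNeg_mul_lap_convExp (ρ : Measure BFMeasure) [IsFiniteMeasure ρ] {f : ℝ → ℝ≥0}
    (hf : Measurable f) : expNeg (lap ρ f) * lap (convExp ρ) f = 1 := by
  rw [← expNeg_mul_tsum (lap_ne_top ρ f), lap, lap, convExp, lintegral_sum_measure]
  congr 2 with k
  rw [lintegral_smul_measure, smul_eq_mul]
  congr 1
  exact lap_convPow ρ hf k

instance (ρ : Measure BFMeasure) [IsFiniteMeasure ρ] : IsFiniteMeasure (convExp ρ) := by
  refine ⟨lt_top_iff_ne_top.2 fun h => ?_⟩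
  have := expNeg_mul_lap_convExp ρ (f := 0) measurable_const
  rw [lap_zero (convExp ρ), h, ENNReal.mul_top] at this
  · simp at this
  · rw [Ne, expNeg_eq_zero]; exact lap_ne_top _ _

/-! ### Increments of the cumulant of an infinitely divisible random measure -/

/-- Infinite divisibility of a law, in terms of its cumulant. -/
def IsInfDiv (ρ : Measure BFMeasure) : Prop :=
  ∀ n : ℕ, 0 < n → ∃ ρ' : Measure BFMeasure, IsProbabilityMeasure ρ' ∧
    ∀ f, Measurable f → lap ρ' f = expNeg (logLap ρ f / n)

lemma lap_withDensity_expNeg (ρ : Measure BFMeasure) {f g : ℝ → ℝ≥0} (hf : Measurable f)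
    (hg : Measurable g) :
    lap (ρ.withDensity fun μ => expNeg (pairing μ.1 g)) f = lap ρ (f + g) := by
  rw [lap, lintegral_withDensity_eq_lintegral_mul _ (measurable_expNeg_pairing hg)
    (measurable_expNeg_pairing hf), lap]
  refine lintegral_congr fun μ => ?_
  rw [pairing_add _ hf, expNeg_add, mul_comm]; rfl

lemma lap_withDensity_one_sub (ρ : Measure BFMeasure) [IsFiniteMeasure ρ] {f g : ℝ → ℝ≥0}
    (hf : Measurable f) (hg : Measurable g) :
    lap (ρ.withDensity fun μ => 1 - expNeg (pairing μ.1 g)) f = lap ρ f - lap ρ (f + g) := by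
  rw [lap, lintegral_withDensity_eq_lintegral_mul _ ((measurable_expNeg_pairing hg).const_sub _)
    (measurable_expNeg_pairing hf), lap, lap, ← lintegral_sub
    (measurable_expNeg_pairing (hf.add hg)) (lap_ne_top ρ (f + g))
    (Eventually.of_forall fun μ => antitone_expNeg (pairing_mono (le_add_of_nonneg_right zero_le)))]
  refine lintegral_congr fun μ => ?_
  rw [pairing_add _ hf, expNeg_add, Pi.mul_apply, ENNReal.sub_mul fun _ _ => expNeg_ne_top _, one_mul,
    mul_comm]

/-- Numerator and denominator are both of order 1/(n + 1); the derivative of t ↦ e^{-at} at 0 gives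
their leading coefficients. -/
lemma tendsto_exp_sub_exp_div (a b : ℝ) {c : ℝ} (hc : c ≠ 0) :
    Tendsto (fun n : ℕ => (Real.exp (-(a / (n + 1))) - Real.exp (-(b / (n + 1)))) /
      (1 - Real.exp (-(c / (n + 1))))) atTop (𝓝 ((b - a) / c)) := by
  have key (a : ℝ) : Tendsto (fun n : ℕ => ((n : ℝ) + 1) * (1 - Real.exp (-(a / (n + 1)))))
      atTop (𝓝 a) := by
    have hd : HasDerivAt (fun t : ℝ => Real.exp (-(a * t))) (-a) 0 := by
      have := (((hasDerivAt_id (0 : ℝ)).const_mul a).neg).exp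
      simpa using this
    have hs := hasDerivAt_iff_tendsto_slope.1 hd
    have ht : Tendsto (fun n : ℕ => 1 / ((n : ℝ) + 1)) atTop (𝓝[≠] 0) :=
      tendsto_nhdsWithin_iff.2 ⟨tendsto_one_div_add_atTop_nhds_zero_nat,
        Eventually.of_forall fun n => by simp only [Set.mem_compl_iff, Set.mem_singleton_iff]; positivity⟩
    have := (hs.comp ht).neg
    rw [neg_neg] at this
    refine this.congr fun n => ?_
    have hn : (n : ℝ) + 1 ≠ 0 := by positivity
    simp only [Function.comp, slope_def_field, mul_zero, neg_zero, Real.exp_zero, sub_zero,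
      mul_one_div]
    field_simp
    ring
  refine (((key b).sub (key a)).div (key c) hc).congr fun n => ?_
  have hn : (n : ℝ) + 1 ≠ 0 := by positivity
  simp only [Pi.div_apply]
  rw [← mul_sub, mul_div_mul_left _ _ hn]
  congr 1
  ring

/-! ### Increments as limits of tilted roots -/

section Tilt
variable {ρ : Measure BFMeasure} [IsProbabilityMeasure ρ] {g : ℝ → ℝ≥0}

/-- Weight the (n + 1)-st root law by 1 - e^{-⟨μ,g⟩} and normalize. Its Laplace functional is a
quotient of differences of e^{-K/(n+1)}, which tends to (K(f + g) - K(f)) / K(g), and compactness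
provides a limit law. The second conclusion says that every continuous identity satisfied by
coordinates of measures survives in the limit. -/
lemma exists_limit_measure (hρ : IsInfDiv ρ) (hg : Measurable g)
    (hfin : ∀ᵐ μ ∂ρ, pairing μ.1 g ≠ ∞) (h0 : logLap ρ g ≠ 0) :
    ∃ P : ProbabilityMeasure CoordSpace,
      (∀ φ f, IsRep φ f → ∫ u, φ u ∂(P : Measure CoordSpace) =
        ((logLap ρ (f + g)).toReal - (logLap ρ f).toReal) / (logLap ρ g).toReal) ∧
      ∀ φ : BoundedContinuousFunction CoordSpace ℝ, (∀ μ, φ (coord μ) = 0) →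
        ∫ u, φ u ∂(P : Measure CoordSpace) = 0 := by
  have hg' : logLap ρ g ≠ ∞ := logLap_ne_top hg hfin
  choose r hr hr' using fun n : ℕ => hρ (n + 1) n.succ_pos
  have hmass (n : ℕ) : 1 - expNeg (logLap ρ g / (n + 1 : ℕ)) ≠ 0 := by
    rw [Ne, one_sub_expNeg_eq_zero, ENNReal.div_eq_zero_iff, not_or]
    exact ⟨h0, ENNReal.natCast_ne_top _⟩
  let τ (n : ℕ) : Measure BFMeasure := (r n).withDensity fun μ => 1 - expNeg (pairing μ.1 g)
  have hτ (n : ℕ) {f : ℝ → ℝ≥0} (hf : Measurable f) : lap (τ n) f =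
      expNeg (logLap ρ f / (n + 1 : ℕ)) - expNeg (logLap ρ (f + g) / (n + 1 : ℕ)) := by
    rw [lap_withDensity_one_sub _ hf hg, hr' n f hf, hr' n _ (hf.add hg)]
  have hτ1 (n : ℕ) : τ n Set.univ = 1 - expNeg (logLap ρ g / (n + 1 : ℕ)) := by
    rw [← lap_zero, hτ n (f := 0) measurable_const, logLap_zero, zero_add]; simp
  let ν (n : ℕ) : Measure BFMeasure := (τ n Set.univ)⁻¹ • τ n
  have hν (n : ℕ) : IsProbabilityMeasure (ν n) := by
    refine ⟨?_⟩
    rw [Measure.smul_apply, smul_eq_mul, ENNReal.inv_mul_cancel]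
    · rw [hτ1]; exact hmass n
    · rw [hτ1]; exact ENNReal.sub_ne_top ENNReal.one_ne_top
  let Q (n : ℕ) : ProbabilityMeasure CoordSpace :=
    ⟨(ν n).map coord, Measure.isProbabilityMeasure_map measurable_coord.aemeasurable⟩
  -- A limit along one free ultrafilter is enough, since the numerical limits exist along the whole
  -- sequence.
  let U : Ultrafilter ℕ := hyperfilter ℕ
  obtain ⟨P, -, hP⟩ := isCompact_univ.ultrafilter_le_nhds (U.map Q) (by simp)
  have hU : (U : Filter ℕ) ≤ atTop := Nat.hyperfilter_le_atTop
  have hT (φ : BoundedContinuousFunction CoordSpace ℝ) :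
      Tendsto (fun n => ∫ u, φ u ∂((ν n).map coord)) U (𝓝 (∫ u, φ u ∂(P : Measure CoordSpace))) :=
    ProbabilityMeasure.tendsto_iff_forall_integral_tendsto.1 hP φ
  refine ⟨P, fun φ f hf => ?_, fun φ hφ => ?_⟩
  · refine tendsto_nhds_unique (hT φ) ?_
    have hf' : logLap ρ f ≠ ∞ :=
      logLap_ne_top hf.measurable (Eventually.of_forall hf.ne_top)
    have hfg' : logLap ρ (f + g) ≠ ∞ := logLap_ne_top (hf.measurable.add hg) <|
      hfin.mono fun μ hμ => by
        rw [pairing_add _ hf.measurable]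
        exact ENNReal.add_ne_top.2 ⟨hf.ne_top μ, hμ⟩
    have hlim := (tendsto_exp_sub_exp_div (logLap ρ f).toReal (logLap ρ (f + g)).toReal
      (ENNReal.toReal_ne_zero.2 ⟨h0, hg'⟩)).mono_left hU
    refine hlim.congr fun n => ?_
    have hd {x : ℝ≥0∞} (hx : x ≠ ∞) : (expNeg (x / (n + 1 : ℕ))).toReal
        = Real.exp (-(x.toReal / (n + 1))) := by
      rw [toReal_expNeg (ENNReal.div_ne_top hx (by simp)), ENNReal.toReal_div,
        ENNReal.toReal_natCast]
      push_cast
      rfl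
    rw [hf.integral_map_coord, lap, lintegral_smul_measure, smul_eq_mul, ENNReal.toReal_mul,
      ENNReal.toReal_inv, hτ1]
    change _ = _ * (lap (τ n) f).toReal
    rw [hτ n hf.measurable, ENNReal.toReal_sub_of_le (expNeg_le_one _) ENNReal.one_ne_top,
      ENNReal.toReal_sub_of_le _ (expNeg_ne_top _), hd hf', hd hfg', hd hg', ENNReal.toReal_one,
      div_eq_inv_mul]
    exact antitone_expNeg (ENNReal.div_le_div_right
      (logLap_mono ρ (le_add_of_nonneg_right zero_le)) _)
  · refine tendsto_nhds_unique (hT φ) (tendsto_const_nhds.congr fun n => ?_)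
    rw [integral_map measurable_coord.aemeasurable φ.continuous.aestronglyMeasurable]
    simp [hφ]

variable {P : ProbabilityMeasure CoordSpace}

/-- By dominated convergence K(f m) → 0 and K(f m + g) → K(g), so the increment formula gives ∫ φ m
dP → 1. Since φ m ≤ 1, Markov's inequality bounds the probability that all φ m stay below 1 - δ by
(1 - ∫ φ m dP) / δ, which tends to 0. -/
lemma ae_exists_lt_of_isRep (hg : Measurable g) (hfin : ∀ᵐ μ ∂ρ, pairing μ.1 g ≠ ∞)
    (h0 : logLap ρ g ≠ 0)
    (hP : ∀ φ f, IsRep φ f → ∫ u, φ u ∂(P : Measure CoordSpace) =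
      ((logLap ρ (f + g)).toReal - (logLap ρ f).toReal) / (logLap ρ g).toReal)
    {φ : ℕ → BoundedContinuousFunction CoordSpace ℝ} {f : ℕ → ℝ → ℝ≥0} {f₀ : ℝ → ℝ≥0}
    (hf : ∀ m, IsRep (φ m) (f m)) (hφ : ∀ m u, φ m u ≤ 1) (hf₀ : Measurable f₀)
    (hfin₀ : ∀ μ : BFMeasure, pairing μ.1 f₀ ≠ ∞)
    (hle : ∀ m, f m ≤ f₀) (hlim : ∀ x, Tendsto (fun m => f m x) atTop (𝓝 0)) {δ : ℝ} (hδ : 0 < δ) :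
    ∀ᵐ u ∂(P : Measure CoordSpace), ∃ m, 1 - δ < φ m u := by
  have hg' : logLap ρ g ≠ ∞ := logLap_ne_top hg hfin
  have h1 : Tendsto (fun m => logLap ρ (f m)) atTop (𝓝 0) := by
    rw [← logLap_zero ρ]
    exact tendsto_logLap (fun m => (hf m).measurable) (Eventually.of_forall fun μ =>
      tendsto_pairing_of_dominated (fun m => (hf m).measurable) hle (hfin₀ μ) hlim)
  have h2 : Tendsto (fun m => logLap ρ (f m + g)) atTop (𝓝 (logLap ρ g)) := by
    refine tendsto_logLap (fun m => (hf m).measurable.add hg) (hfin.mono fun μ hμ => ?_)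
    refine tendsto_pairing_of_dominated (g := f₀ + g) (fun m => (hf m).measurable.add hg)
      (fun m => add_le_add_left (hle m) g) ?_ fun x => ?_
    · rw [pairing_add _ hf₀]
      exact ENNReal.add_ne_top.2 ⟨hfin₀ μ, hμ⟩
    · simpa using (hlim x).add_const (g x)
  have h3 : Tendsto (fun m => ∫ u, φ m u ∂(P : Measure CoordSpace)) atTop (𝓝 1) := by
    have := (((ENNReal.tendsto_toReal hg').comp h2).sub
      ((ENNReal.tendsto_toReal ENNReal.zero_ne_top).comp h1)).div_const (logLap ρ g).toReal
    rw [ENNReal.toReal_zero, sub_zero, div_self (ENNReal.toReal_ne_zero.2 ⟨h0, hg'⟩)] at this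
    exact this.congr fun m => (hP _ _ (hf m)).symm
  rw [ae_iff]
  simp only [not_exists, not_lt]
  rw [← measureReal_eq_zero_iff]
  refine le_antisymm (ge_of_tendsto' (x := atTop)
    (f := fun m => (1 - ∫ u, φ m u ∂(P : Measure CoordSpace)) / δ) ?_ fun m => ?_)
    measureReal_nonneg
  · simpa using ((h3.const_sub 1).div_const δ)
  · have hint : Integrable (fun u => 1 - φ m u) (P : Measure CoordSpace) :=
      (integrable_const _).sub ((φ m).integrable _)
    have := mul_meas_ge_le_integral_of_nonneg
      (Eventually.of_forall fun u => sub_nonneg.2 (hφ m u)) hint δ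
    rw [integral_sub (integrable_const _) ((φ m).integrable _)] at this
    rw [le_div_iff₀' hδ]
    refine le_trans (mul_le_mul_of_nonneg_left (measureReal_mono fun u hu => ?_) hδ.le)
      (this.trans (by simp))
    have := hu m
    simp only [Set.mem_ofPred_eq]
    linarith

lemma coordPow_le_one (i : ℚ × ℚ) (t : ℝ≥0) (u : CoordSpace) : coordPow i t u ≤ 1 :=
  Real.rpow_le_one (u i).2.1 (u i).2.2 t.2

/-- The limit law charges only genuine measures. The two equalities defining `goodCoord` are closed
conditions and pass to the limit; positivity and right continuity are not closed and come from
`ae_exists_lt_of_isRep`. -/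
lemma ae_mem_goodCoord (hg : Measurable g) (hfin : ∀ᵐ μ ∂ρ, pairing μ.1 g ≠ ∞)
    (h0 : logLap ρ g ≠ 0)
    (hP : ∀ φ f, IsRep φ f → ∫ u, φ u ∂(P : Measure CoordSpace) =
      ((logLap ρ (f + g)).toReal - (logLap ρ f).toReal) / (logLap ρ g).toReal)
    (hP0 : ∀ φ : BoundedContinuousFunction CoordSpace ℝ, (∀ μ, φ (coord μ) = 0) →
      ∫ u, φ u ∂(P : Measure CoordSpace) = 0) :
    ∀ᵐ u ∂(P : Measure CoordSpace), u ∈ goodCoord := by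
  have hz (φ : BoundedContinuousFunction CoordSpace ℝ) (hφ : ∀ μ, φ (coord μ) = 0) :
      ∀ᵐ u ∂(P : Measure CoordSpace), φ u = 0 := by
    -- Squaring makes the integrand nonnegative, so a zero integral forces φ = 0 almost everywhere.
    have h1 := hP0 (φ * φ) fun μ => by simp [hφ]
    rw [integral_eq_zero_iff_of_nonneg (f := fun u => (φ * φ) u) (fun u => mul_self_nonneg (φ u)) ((φ * φ).integrable _)] at h1
    filter_upwards [h1] with u hu
    exact mul_self_eq_zero.1 hu
  have hbd (i : ℚ × ℚ) (t : ℝ≥0) := (IsRep.coordPow i t).ne_top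
  refine Filter.Eventually.and (ae_all_iff.2 fun i => ?_) (Filter.Eventually.and ?_
    (Filter.Eventually.and ?_ ?_))
  -- Exponents 1 / (m + 1) tending to 0, with δ = 1: some power of the coordinate is positive, hence
  -- so is the coordinate.
  · have := ae_exists_lt_of_isRep (P := P) hg hfin h0 hP
      (fun m : ℕ => IsRep.coordPow i (1 / ((m : ℝ≥0) + 1)))
      (fun m u => coordPow_le_one _ _ _) (IsRep.coordPow i 1).measurable (hbd i 1)
      (fun m x => Set.indicator_le_indicator (f := fun _ => 1 / ((m : ℝ≥0) + 1)) (g := fun _ => 1)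
        (by simp only [one_div]; exact inv_le_one_of_one_le₀ (by simp)))
      (fun x => by
        by_cases hx : x ∈ Set.Ioc (i.1 : ℝ) i.2
        · simpa only [Set.indicator_of_mem hx] using tendsto_one_div_add_atTop_nhds_zero_nat (𝕜 := ℝ≥0)
        · simp [Set.indicator_of_notMem hx]) (δ := 1) one_pos
    filter_upwards [this] with u ⟨m, hm⟩
    refine lt_of_le_of_ne (u i).2.1 fun h => ?_
    rw [sub_self, coordPow_apply, ← h, Real.zero_rpow] at hm
    · exact lt_irrefl _ hm
    · have : (0 : ℝ≥0) < 1 / (m + 1) := by positivity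
      exact_mod_cast this.ne'
  · refine ae_all_iff.2 fun a => ae_all_iff.2 fun b => ae_all_iff.2 fun hab => ?_
    filter_upwards [hz (1 - coordPow (a, b) 1) fun μ => by
      simp [coordPow_one, (coord_mem_goodCoord μ).2.1 a b hab]] with u hu
    simp only [BoundedContinuousFunction.coe_sub, BoundedContinuousFunction.coe_one, Pi.sub_apply,
      Pi.one_apply, coordPow_one] at hu
    linarith
  · refine ae_all_iff.2 fun a => ae_all_iff.2 fun b => ae_all_iff.2 fun c => ae_all_iff.2 fun hab =>
      ae_all_iff.2 fun hbc => ?_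
    filter_upwards [hz (coordPow (a, c) 1 - coordPow (a, b) 1 * coordPow (b, c) 1) fun μ => by
      simp [coordPow_one, (coord_mem_goodCoord μ).2.2.1 a b c hab hbc]] with u hu
    simp only [BoundedContinuousFunction.coe_sub, BoundedContinuousFunction.coe_mul, Pi.sub_apply,
      Pi.mul_apply, coordPow_one] at hu
    linarith
  · refine ae_all_iff.2 fun a => ae_all_iff.2 fun k => ?_
    have := ae_exists_lt_of_isRep (P := P) hg hfin h0 hP
      (fun m : ℕ => IsRep.coordPow (a, a + 1 / ((m : ℚ) + 1)) 1)
      (fun m u => coordPow_le_one _ _ _) (IsRep.coordPow (a, a + 1) 1).measurable (hbd (a, a + 1) 1)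
      (fun m => Set.indicator_le_indicator_of_subset (Set.Ioc_subset_Ioc_right (by
        have h : (1 : ℚ) / (m + 1) ≤ 1 := by
          rw [one_div]; exact inv_le_one_of_one_le₀ (by simp)
        exact_mod_cast add_le_add_right h a)) (fun _ => zero_le))
      (fun x => by
        refine tendsto_const_nhds.congr' ?_
        rcases le_or_gt x a with hx | hx
        · exact Eventually.of_forall fun m => by
            refine (Set.indicator_of_notMem ?_ _).symm; exact fun h => (h.1.trans_le hx).false
        · have := tendsto_one_div_add_atTop_nhds_zero_nat (𝕜 := ℝ)
          filter_upwards [this.eventually (gt_mem_nhds (sub_pos.2 hx))] with m hm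
          refine (Set.indicator_of_notMem ?_ _).symm
          intro h
          have := h.2
          push_cast at this
          linarith) (δ := 1 / ((k : ℝ) + 1)) (by positivity)
    simpa only [coordPow_one] using this

/-- The increments of the cumulant of an infinitely divisible random measure are Laplace
functionals of finite measures. -/
theorem exists_tilt (hρ : IsInfDiv ρ) (hg : Measurable g) (hfin : ∀ᵐ μ ∂ρ, pairing μ.1 g ≠ ∞) :
    ∃ σ : Measure BFMeasure, IsFiniteMeasure σ ∧
      ∀ f, Measurable f → logLap ρ (f + g) = logLap ρ f + lap σ f := by
  suffices ∃ σ : Measure BFMeasure, IsFiniteMeasure σ ∧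
      ∀ φ f, IsRep φ f → logLap ρ (f + g) = logLap ρ f + lap σ f by
    obtain ⟨σ, hσ, h⟩ := this
    refine ⟨σ, hσ, fun f hf => ?_⟩
    have : IsFiniteMeasure (ρ.withDensity fun μ => expNeg (pairing μ.1 g)) :=
      isFiniteMeasure_withDensity (lap_ne_top ρ g)
    -- The increment formula, known on test functions, is exponentiated to the identity of finite
    -- measures ρ = (e^{-⟨·,g⟩} ρ) * exp(σ). Such an identity extends to all measurable f, infinite
    -- cumulants included.
    have he : conv (ρ.withDensity fun μ => expNeg (pairing μ.1 g)) (convExp σ) = ρ := by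
      refine ext_of_lap fun φ f hf => ?_
      rw [lap_conv _ _ hf.measurable, lap_withDensity_expNeg _ hf.measurable hg,
        ← expNeg_logLap ρ, h φ f hf, expNeg_add, mul_assoc,
        expNeg_mul_lap_convExp _ hf.measurable, mul_one, expNeg_logLap]
    have h2 : lap ρ f = lap ρ (f + g) * lap (convExp σ) f := by
      conv_lhs => rw [← he]
      rw [lap_conv _ _ hf, lap_withDensity_expNeg _ hf hg]
    rw [← expNeg_inj, expNeg_add, expNeg_logLap, expNeg_logLap, h2, mul_assoc,
      mul_comm (lap (convExp σ) f), expNeg_mul_lap_convExp _ hf, mul_one]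
  have hg' : logLap ρ g ≠ ∞ := logLap_ne_top hg hfin
  by_cases h0 : logLap ρ g = 0
  · refine ⟨0, inferInstance, fun φ f hf => ?_⟩
    have h1 : lap ρ g = 1 := by rw [← expNeg_logLap, h0, expNeg_zero]
    have h2 : ∀ᵐ μ ∂ρ, pairing μ.1 g = 0 := by
      have h3 : ∫⁻ μ, (1 - expNeg (pairing μ.1 g)) ∂ρ = 0 := by
        rw [lintegral_sub (measurable_expNeg_pairing hg) (lap_ne_top ρ g)
          (Eventually.of_forall fun μ => expNeg_le_one _)]
        change _ - lap ρ g = 0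
        rw [h1]; simp
      rw [lintegral_eq_zero_iff ((measurable_expNeg_pairing hg).const_sub _)] at h3
      exact h3.mono fun μ hμ => one_sub_expNeg_eq_zero.1 hμ
    have h3 : lap (0 : Measure BFMeasure) f = 0 := by simp [lap]
    rw [h3, add_zero, logLap, logLap]
    congr 1
    refine lintegral_congr_ae (h2.mono fun μ hμ => ?_)
    simp only [pairing_add _ hf.measurable, hμ, add_zero]
  · obtain ⟨P, hP, hP0⟩ := exists_limit_measure hρ hg hfin h0
    have hgood := ae_mem_goodCoord hg hfin h0 hP hP0
    -- P is carried by the range of `coord`, so pulling it back loses no mass.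
    have hmap : ((P : Measure CoordSpace).comap coord).map coord = P := by
      rw [measurableEmbedding_coord.map_comap, range_coord]
      exact Measure.restrict_eq_self_of_ae_mem hgood
    have hfinite : IsFiniteMeasure ((P : Measure CoordSpace).comap coord) := by
      refine ⟨?_⟩
      rw [← Set.preimage_univ (f := coord), ← Measure.map_apply measurable_coord .univ, hmap]
      exact measure_lt_top _ _
    -- The factor K(g) undoes the normalization of the approximating laws.
    refine ⟨logLap ρ g • (P : Measure CoordSpace).comap coord, ?_, fun φ f hf => ?_⟩
    · refine ⟨?_⟩
      rw [Measure.smul_apply, smul_eq_mul]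
      exact ENNReal.mul_lt_top hg'.lt_top (measure_lt_top _ _)
    have hf' : logLap ρ f ≠ ∞ :=
      logLap_ne_top hf.measurable (Eventually.of_forall hf.ne_top)
    have hfg' : logLap ρ (f + g) ≠ ∞ := logLap_ne_top (hf.measurable.add hg) <|
      hfin.mono fun μ hμ => by
        rw [pairing_add _ hf.measurable]
        exact ENNReal.add_ne_top.2 ⟨hf.ne_top μ, hμ⟩
    have h1 := hP φ f hf
    nth_rewrite 1 [← hmap] at h1
    rw [hf.integral_map_coord, eq_div_iff (ENNReal.toReal_ne_zero.2 ⟨h0, hg'⟩)] at h1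
    have h2 : lap (logLap ρ g • (P : Measure CoordSpace).comap coord) f
        = logLap ρ g * lap ((P : Measure CoordSpace).comap coord) f := by
      rw [lap, lintegral_smul_measure, smul_eq_mul, lap]
    have h3 := ENNReal.mul_ne_top hg' (lap_ne_top ((P : Measure CoordSpace).comap coord) f)
    rw [h2, ← ENNReal.toReal_eq_toReal_iff' hfg' (ENNReal.add_ne_top.2 ⟨hf', h3⟩),
      ENNReal.toReal_add hf' h3, ENNReal.toReal_mul]
    linarith
end Tilt

/-! ### The Lévy–Khintchine form of a cumulant -/

lemma measurableSet_ne_zero : MeasurableSet {μ : BFMeasure | μ.1 ≠ 0} := by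
  have : {μ : BFMeasure | μ.1 ≠ 0} = ((fun μ : BFMeasure => μ.1 Set.univ) ⁻¹' {0})ᶜ := by
    ext μ; simp
  rw [this]
  exact (measurable_eval .univ (measurableSet_singleton 0)).compl

lemma measurableEmbedding_val : MeasurableEmbedding (Subtype.val : BFMeasureStar → BFMeasure) :=
  MeasurableEmbedding.subtype_coe measurableSet_ne_zero

lemma pairing_ne_zero {μ : Measure ℝ} (hμ : μ ≠ 0) {h : ℝ → ℝ≥0} (hm : Measurable h)
    (hpos : ∀ x, 0 < h x) : pairing μ h ≠ 0 := by
  rw [pairing, Ne, lintegral_eq_zero_iff hm.coe_nnreal_ennreal]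
  intro h0
  have : ∀ᵐ x ∂μ, False := h0.mono fun x hx => (hpos x).ne' (by simpa using hx)
  simp only [ae_iff, not_false_eq_true] at this
  exact hμ (Measure.measure_univ_eq_zero.1 (by simpa using this))

@[fun_prop]
lemma measurable_star_one_sub {f : ℝ → ℝ≥0} (hf : Measurable f) :
    Measurable fun μ : BFMeasureStar => 1 - expNeg (pairing μ.1.1 f) :=
  ((measurable_expNeg_pairing hf).comp measurable_subtype_coe).const_sub _

@[fun_prop]
lemma measurable_star_expNeg {f : ℝ → ℝ≥0} (hf : Measurable f) :
    Measurable fun μ : BFMeasureStar => expNeg (pairing μ.1.1 f) :=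
  (measurable_expNeg_pairing hf).comp measurable_subtype_coe

/-- The part of the cumulant which is due to the Lévy measure. -/
def levyForm (Λ : Measure BFMeasureStar) (f : ℝ → ℝ≥0) : ℝ≥0∞ :=
  ∫⁻ μ, (1 - expNeg (pairing μ.1.1 f)) ∂Λ

/-- The Lévy–Khintchine form with drift `l` and Lévy measure `Λ`. -/
def lkForm (l : Measure ℝ) (Λ : Measure BFMeasureStar) (f : ℝ → ℝ≥0) : ℝ≥0∞ :=
  pairing l f + levyForm Λ f

lemma levyForm_mono {Λ : Measure BFMeasureStar} {f g : ℝ → ℝ≥0} (h : f ≤ g) :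
    levyForm Λ f ≤ levyForm Λ g :=
  lintegral_mono fun _ => tsub_le_tsub_left (antitone_expNeg (pairing_mono h)) _

lemma levyForm_add (Λ : Measure BFMeasureStar) {f g : ℝ → ℝ≥0} (hf : Measurable f) :
    levyForm Λ (f + g) = levyForm Λ f +
      ∫⁻ μ, expNeg (pairing μ.1.1 f) * (1 - expNeg (pairing μ.1.1 g)) ∂Λ := by
  simp only [levyForm, pairing_add _ hf, one_sub_expNeg_add]
  exact lintegral_add_left (measurable_star_one_sub hf) _

lemma tendsto_levyForm {Λ : Measure BFMeasureStar} {f : ℕ → ℝ → ℝ≥0} {f₀ : ℝ → ℝ≥0}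
    (hf : ∀ n, Measurable (f n)) (hmono : Monotone f)
    (h : ∀ x, Tendsto (fun n => f n x) atTop (𝓝 (f₀ x))) :
    Tendsto (fun n => levyForm Λ (f n)) atTop (𝓝 (levyForm Λ f₀)) :=
  lintegral_tendsto_of_tendsto_of_monotone
    (fun n => (measurable_star_one_sub (hf n)).aemeasurable)
    (Eventually.of_forall fun _ _ _ hmn =>
      tsub_le_tsub_left (antitone_expNeg (pairing_mono (hmono hmn))) _)
    (Eventually.of_forall fun _ => ENNReal.Tendsto.sub tendsto_const_nhds
      ((continuous_expNeg.tendsto _).comp (tendsto_pairing_of_monotone hf hmono h))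
      (Or.inl ENNReal.one_ne_top))

/-- The finite measure on the space of boundedly finite measures whose Laplace functional is the
increment of the Lévy–Khintchine form in the direction of `h`. -/
def tiltMeasure (l : Measure ℝ) (Λ : Measure BFMeasureStar) (h : ℝ → ℝ≥0) : Measure BFMeasure :=
  pairing l h • Measure.dirac BFMeasure.zero +
    (Λ.withDensity fun μ => 1 - expNeg (pairing μ.1.1 h)).map Subtype.val

lemma lap_tiltMeasure (l : Measure ℝ) (Λ : Measure BFMeasureStar) {f h : ℝ → ℝ≥0}
    (hf : Measurable f) (hh : Measurable h) : lap (tiltMeasure l Λ h) f = pairing l h +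
      ∫⁻ μ, expNeg (pairing μ.1.1 f) * (1 - expNeg (pairing μ.1.1 h)) ∂Λ := by
  rw [lap, tiltMeasure, lintegral_add_measure, lintegral_smul_measure,
    lintegral_dirac' _ (measurable_expNeg_pairing hf),
    lintegral_map (measurable_expNeg_pairing hf) measurable_subtype_coe,
    lintegral_withDensity_eq_lintegral_mul _ (measurable_star_one_sub hh)
      (measurable_star_expNeg hf)]
  congr 1
  · simp [BFMeasure.zero]
  · exact lintegral_congr fun μ => mul_comm _ _

/-- As a function of f, the increment in direction h sees the drift only through the constant ⟨l,
h⟩, which is an atom at the zero measure. -/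
lemma lkForm_add (l : Measure ℝ) (Λ : Measure BFMeasureStar) {f h : ℝ → ℝ≥0}
    (hf : Measurable f) (hh : Measurable h) :
    lkForm l Λ (f + h) = lkForm l Λ f + lap (tiltMeasure l Λ h) f := by
  rw [lkForm, lkForm, lap_tiltMeasure l Λ hf hh, pairing_add _ hf, levyForm_add Λ hf]
  ring

/-- The drift atom sits at the zero measure, outside the image, so restricting to nonzero measures
isolates the Lévy part. -/
lemma tiltMeasure_image (l : Measure ℝ) (Λ : Measure BFMeasureStar) (h : ℝ → ℝ≥0)
    {B : Set BFMeasureStar} (hB : MeasurableSet B) :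
    tiltMeasure l Λ h (Subtype.val '' B) =
      Λ.withDensity (fun μ => 1 - expNeg (pairing μ.1.1 h)) B := by
  have h1 : MeasurableSet (Subtype.val '' B) := measurableEmbedding_val.measurableSet_image' hB
  have h2 : BFMeasure.zero ∉ Subtype.val '' B := by
    rintro ⟨μ, -, hμ⟩
    exact μ.2 (by rw [hμ]; rfl)
  rw [tiltMeasure, Measure.add_apply, Measure.smul_apply, Measure.dirac_apply' _ h1,
    Set.indicator_of_notMem h2, smul_zero, zero_add, measurableEmbedding_val.map_apply,
    Set.preimage_image_eq _ Subtype.val_injective]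

/-- Uniqueness of the drift and of the Lévy measure. -/
theorem lkForm_unique {l l' : Measure ℝ} {Λ Λ' : Measure BFMeasureStar} {h : ℝ → ℝ≥0}
    (hh : Measurable h) (hpos : ∀ x, 0 < h x) (hfin : lkForm l Λ h ≠ ∞)
    (hrep : ∀ f, Measurable f → (∀ μ : BFMeasure, pairing μ.1 f ≠ ∞) → lkForm l Λ f ≠ ∞)
    (heq : ∀ f, Measurable f → lkForm l Λ f = lkForm l' Λ' f) : Λ = Λ' ∧ l = l' := by
  have hfinite (l : Measure ℝ) (Λ : Measure BFMeasureStar) (hfin : lkForm l Λ h ≠ ∞) :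
      IsFiniteMeasure (tiltMeasure l Λ h) := by
    refine ⟨?_⟩
    rw [← lap_zero, lap_tiltMeasure l Λ (f := 0) measurable_const hh]
    simpa [lkForm, levyForm] using hfin.lt_top
  have := hfinite l Λ hfin
  have := hfinite l' Λ' (heq h hh ▸ hfin)
  -- Equal forms have equal increments, `hrep` allowing the common term at f to be cancelled; the
  -- increments determine the tilted measures.
  have ht : tiltMeasure l Λ h = tiltMeasure l' Λ' h := by
    refine ext_of_lap fun φ f hf => ?_
    have h1 := lkForm_add l Λ hf.measurable hh
    rw [heq _ (hf.measurable.add hh), lkForm_add l' Λ' hf.measurable hh,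
      ← heq f hf.measurable] at h1
    exact ((ENNReal.add_right_inj (hrep f hf.measurable hf.ne_top)).1 h1).symm
  have hw : Λ.withDensity (fun μ => 1 - expNeg (pairing μ.1.1 h))
      = Λ'.withDensity (fun μ => 1 - expNeg (pairing μ.1.1 h)) :=
    Measure.ext fun B hB => by rw [← tiltMeasure_image l Λ h hB, ht, tiltMeasure_image l' Λ' h hB]
  -- As h > 0, the weight 1 - e^{-⟨μ,h⟩} is positive and finite at every nonzero μ and can be
  -- divided out.
  have hinv (Λ : Measure BFMeasureStar) := withDensity_inv_same (μ := Λ)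
    (measurable_star_one_sub hh)
    (Eventually.of_forall fun μ => mt one_sub_expNeg_eq_zero.1 (pairing_ne_zero μ.2 hh hpos))
    (Eventually.of_forall fun μ => ENNReal.sub_ne_top ENNReal.one_ne_top)
  have hΛ : Λ = Λ' := by rw [← hinv Λ, hw, hinv Λ']
  refine ⟨hΛ, ?_⟩
  subst hΛ
  -- With a common Lévy measure, testing on the functions h 1_A leaves the drift after cancelling a
  -- finite Lévy term.
  have hwl : l.withDensity (fun x => (h x : ℝ≥0∞)) = l'.withDensity (fun x => (h x : ℝ≥0∞)) := by
    refine Measure.ext fun A hA => ?_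
    have hle : A.indicator h ≤ h := Set.indicator_le_self' fun _ _ => zero_le
    have h1 := heq _ (hh.indicator hA)
    rw [lkForm, lkForm, ENNReal.add_left_inj
      (ne_top_of_le_ne_top hfin ((levyForm_mono hle).trans le_add_self))] at h1
    have h2 (l : Measure ℝ) : pairing l (A.indicator h) = ∫⁻ x in A, (h x : ℝ≥0∞) ∂l := by
      rw [← lintegral_indicator hA, pairing]
      refine lintegral_congr fun x => ?_
      by_cases hx : x ∈ A <;> simp [hx]
    rw [withDensity_apply _ hA, withDensity_apply _ hA, ← h2, ← h2, h1]
  have hinvl (l : Measure ℝ) := withDensity_inv_same (μ := l) hh.coe_nnreal_ennreal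
    (Eventually.of_forall fun x => ENNReal.coe_ne_zero.2 (hpos x).ne')
    (Eventually.of_forall fun x => ENNReal.coe_ne_top)
  rw [← hinvl l, hwl, hinvl l']

/-! ### Additive functions on the half-line -/

/-- Cauchy's equation: values in [0, ∞] make an additive φ monotone, so linearity on integers forces
linearity everywhere. The condition φ 0 = 0 excludes φ = ∞. -/
lemma eq_mul_of_additive {φ : ℝ≥0 → ℝ≥0∞} (h0 : φ 0 = 0) (hadd : ∀ s t, φ (s + t) = φ s + φ t)
    (t : ℝ≥0) : φ t = t * φ 1 := by
  have hmono : Monotone φ := fun s t hst => by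
    rw [← add_tsub_cancel_of_le hst, hadd]; exact le_self_add
  have hmul (n : ℕ) (t : ℝ≥0) : φ (n * t) = n * φ t := by
    induction n with
    | zero => simp [h0]
    | succ n ih => push_cast; rw [add_mul, one_mul, hadd, ih, add_mul, one_mul]
  have hnat (n : ℕ) : φ n = n * φ 1 := by rw [← hmul, mul_one]
  by_cases h1 : φ 1 = ∞
  · rcases eq_or_ne t 0 with rfl | ht
    · simp [h0]
    · obtain ⟨n, hn⟩ := exists_nat_ge t⁻¹
      have h2 : 1 ≤ n * t := by
        rw [← inv_mul_cancel₀ ht]; gcongr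
      have h3 : (n : ℝ≥0∞) * φ t = ∞ := by
        rw [← hmul, ← top_le_iff, ← h1]; exact hmono h2
      rw [h1, ENNReal.mul_top (ENNReal.coe_ne_zero.2 ht)]
      by_contra h4
      exact ENNReal.mul_ne_top (ENNReal.natCast_ne_top n) h4 h3
  · have hfin (t : ℝ≥0) : φ t ≠ ∞ := by
      obtain ⟨n, hn⟩ := exists_nat_ge t
      refine ne_top_of_le_ne_top ?_ (hmono hn)
      rw [hnat]; exact ENNReal.mul_ne_top (ENNReal.natCast_ne_top n) h1
    rw [← ENNReal.toReal_eq_toReal_iff' (hfin t) (ENNReal.mul_ne_top ENNReal.coe_ne_top h1),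
      ENNReal.toReal_mul, ENNReal.coe_toReal, ← sub_eq_zero]
    by_contra hne
    have hb : 0 ≤ (φ 1).toReal := ENNReal.toReal_nonneg
    -- Comparing n t with the integers around it bounds n times the discrepancy by φ 1; this n is
    -- chosen too large for that.
    obtain ⟨n, hn⟩ := exists_nat_gt ((φ 1).toReal / |(φ t).toReal - t * (φ 1).toReal|)
    rw [div_lt_iff₀ (abs_pos.2 hne)] at hn
    have e1 : (⌊n * t⌋₊ : ℝ) * (φ 1).toReal ≤ n * (φ t).toReal := by
      have := ENNReal.toReal_mono (hfin _) (hmono (Nat.floor_le (zero_le (a := n * t))))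
      rwa [hnat, hmul, ENNReal.toReal_mul, ENNReal.toReal_mul, ENNReal.toReal_natCast,
        ENNReal.toReal_natCast] at this
    have e2 : (n : ℝ) * (φ t).toReal ≤ (⌊n * t⌋₊ + 1) * (φ 1).toReal := by
      have := ENNReal.toReal_mono (hfin _) (hmono (Nat.lt_floor_add_one (n * t)).le)
      rw [← Nat.cast_succ, hnat, hmul, ENNReal.toReal_mul, ENNReal.toReal_mul,
        ENNReal.toReal_natCast, ENNReal.toReal_natCast] at this
      simpa using this
    have e3 : (⌊n * t⌋₊ : ℝ) ≤ n * t := by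
      exact_mod_cast Nat.floor_le (zero_le (a := n * t))
    have e4 : (n : ℝ) * t ≤ ⌊n * t⌋₊ + 1 := by
      exact_mod_cast (Nat.lt_floor_add_one (n * t)).le
    have e5 : |(n : ℝ) * ((φ t).toReal - t * (φ 1).toReal)| ≤ (φ 1).toReal := by
      have := mul_le_mul_of_nonneg_right e3 hb
      have := mul_le_mul_of_nonneg_right e4 hb
      rw [abs_le]; constructor <;> linarith
    rw [abs_mul, Nat.abs_cast] at e5
    linarith

/-! ### A strictly positive test function with almost surely finite pairing -/

lemma expNeg_mul_self_le (t : ℝ≥0∞) : expNeg t * t ≤ 1 - expNeg t := by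
  rcases eq_or_ne t ∞ with rfl | ht
  · simp
  refine ENNReal.le_sub_of_add_le_left (expNeg_ne_top t) ?_
  rw [← mul_one_add]
  have h1 : expNeg t * (1 + t) = ENNReal.ofReal (Real.exp (-t.toReal) * (1 + t.toReal)) := by
    rw [ENNReal.ofReal_mul (Real.exp_pos _).le, ← expNeg_of_ne_top ht,
      ENNReal.ofReal_add zero_le_one ENNReal.toReal_nonneg, ENNReal.ofReal_one,
      ENNReal.ofReal_toReal ht]
  rw [h1, ENNReal.ofReal_le_one, Real.exp_neg, inv_mul_le_iff₀ (Real.exp_pos _)]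
  linarith [Real.add_one_le_exp t.toReal]

/-- All but finitely many terms satisfy 1 - e^{-t} < 1/2, and there t ≤ 2 (1 - e^{-t}) because t
e^{-t} ≤ 1 - e^{-t}. -/
lemma tsum_ne_top_of_one_sub_expNeg {ι : Type*} {t : ι → ℝ≥0∞} (ht : ∀ i, t i ≠ ∞)
    (h : ∑' i, (1 - expNeg (t i)) ≠ ∞) : ∑' i, t i ≠ ∞ := by
  classical
  have h1 := ENNReal.tendsto_cofinite_zero_of_tsum_ne_top h
  have h2 : ∀ᶠ i in cofinite, 1 - expNeg (t i) < 2⁻¹ :=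
    h1.eventually (gt_mem_nhds (by simp))
  have hF : {i | ¬ (1 - expNeg (t i) < 2⁻¹)}.Finite := h2
  set F := hF.toFinset
  have hle (i : ι) : t i ≤ 2 * (1 - expNeg (t i)) + (if i ∈ F then t i else 0) := by
    by_cases hi : i ∈ F
    · simp [hi]
    · have hi' : 1 - expNeg (t i) < 2⁻¹ := by simpa [F] using hi
      have h3 : 2⁻¹ ≤ expNeg (t i) := by
        by_contra! h4
        have := ENNReal.add_lt_add h4 hi'
        rw [expNeg_add_one_sub, ENNReal.inv_two_add_inv_two] at this
        exact this.false
      rw [if_neg hi, add_zero]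
      calc t i = 2 * (2⁻¹ * t i) := by
            rw [← mul_assoc, ENNReal.mul_inv_cancel two_ne_zero ENNReal.ofNat_ne_top, one_mul]
        _ ≤ 2 * (expNeg (t i) * t i) := by gcongr
        _ ≤ _ := by gcongr; exact expNeg_mul_self_le _
  refine ne_top_of_le_ne_top ?_ (ENNReal.tsum_le_tsum hle)
  rw [ENNReal.tsum_add, ENNReal.tsum_mul_left]
  refine ENNReal.add_ne_top.2 ⟨ENNReal.mul_ne_top ENNReal.ofNat_ne_top h, ?_⟩
  rw [tsum_eq_sum (s := F) fun i hi => if_neg hi]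
  exact ENNReal.sum_ne_top.2 fun i _ => by split_ifs; simp [ht]

lemma pairing_eq_tsum_ceil (μ : Measure ℝ) (s : ℤ → ℝ≥0) :
    pairing μ (fun x => s ⌈x⌉) = ∑' n : ℤ, (s (n + 1) : ℝ≥0∞) * μ (Set.Ioc (n : ℝ) (n + 1)) := by
  rw [pairing, ← setLIntegral_univ, ← iUnion_Ioc_intCast ℝ,
    lintegral_iUnion (fun _ => measurableSet_Ioc) (Set.pairwise_disjoint_Ioc_intCast ℝ)]
  refine tsum_congr fun n => ?_
  rw [← setLIntegral_const]
  refine setLIntegral_congr_fun measurableSet_Ioc fun x hx => ?_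
  have : ⌈x⌉ = n + 1 := by
    rw [Int.ceil_eq_iff]; push_cast; exact ⟨by linarith [hx.1], hx.2⟩
  simp only [this]

/-- Take h constant on each (n, n + 1], with value s n so small that E[1 - e^{-s n μ(n, n+1]}] is
summable in n; then Σ s n μ(n, n+1] is almost surely finite. Strict positivity makes 1 - e^{-⟨μ,h⟩}
an invertible weight on nonzero measures. -/
lemma exists_pos_pairing_ne_top (ρ : Measure BFMeasure) [IsProbabilityMeasure ρ] :
    ∃ h : ℝ → ℝ≥0, Measurable h ∧ (∀ x, 0 < h x) ∧ ∀ᵐ μ ∂ρ, pairing μ.1 h ≠ ∞ := by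
  obtain ⟨ε, hε, hsum⟩ := ENNReal.exists_pos_sum_of_countable' one_ne_zero ℤ
  let I (n : ℤ) : Set ℝ := Set.Ioc (n : ℝ) (n + 1)
  have hI (n : ℤ) (μ : BFMeasure) : μ.1 (I n) ≠ ∞ := μ.Ioc_ne_top _ _
  have hmeas (n : ℤ) (s : ℝ≥0) : Measurable fun μ : BFMeasure => 1 - expNeg (s * μ.1 (I n)) :=
    (measurable_expNeg.comp ((measurable_eval measurableSet_Ioc).const_mul _)).const_sub _
  have hex (n : ℤ) : ∃ s : ℝ≥0, 0 < s ∧ ∫⁻ μ, (1 - expNeg (s * μ.1 (I n))) ∂ρ < ε n := by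
    have hlim : Tendsto (fun k : ℕ => ∫⁻ μ, (1 - expNeg (((1 / ((k : ℝ≥0) + 1) : ℝ≥0) : ℝ≥0∞) *
        μ.1 (I n))) ∂ρ) atTop (𝓝 (∫⁻ _, 0 ∂ρ)) := by
      refine tendsto_lintegral_of_dominated_convergence (fun _ => 1) (fun k => hmeas n _)
        (fun k => Eventually.of_forall fun μ => tsub_le_self) (by simp)
        (Eventually.of_forall fun μ => ?_)
      have h1 : Tendsto (fun k : ℕ => ((1 / ((k : ℝ≥0) + 1) : ℝ≥0) : ℝ≥0∞) * μ.1 (I n)) atTop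
          (𝓝 (0 * μ.1 (I n))) :=
        ENNReal.Tendsto.mul_const
          (ENNReal.tendsto_coe.2 (tendsto_one_div_add_atTop_nhds_zero_nat (𝕜 := ℝ≥0)))
          (Or.inr (hI n μ))
      have h2 := ENNReal.Tendsto.sub (tendsto_const_nhds (x := (1 : ℝ≥0∞)))
        ((continuous_expNeg.tendsto _).comp h1) (Or.inl ENNReal.one_ne_top)
      simpa using h2
    rw [lintegral_zero] at hlim
    obtain ⟨k, hk⟩ := (hlim.eventually (gt_mem_nhds (hε n))).exists
    exact ⟨1 / (k + 1), by positivity, hk⟩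
  choose s hs hs' using hex
  -- On (n, n + 1] the ceiling is n + 1, so the value there is s n.
  refine ⟨fun x => s (⌈x⌉ - 1), ?_, fun x => hs _, ?_⟩
  · exact (measurable_from_top (f := fun n : ℤ => s (n - 1))).comp Int.measurable_ceil
  · have hfin : ∫⁻ μ, ∑' n, (1 - expNeg (s n * μ.1 (I n))) ∂ρ ≠ ∞ := by
      rw [lintegral_tsum fun n => (hmeas n _).aemeasurable]
      exact ne_top_of_le_ne_top (hsum.trans ENNReal.one_lt_top).ne
        (ENNReal.tsum_le_tsum fun n => (hs' n).le)
    filter_upwards [ae_lt_top (Measurable.tsum fun n => hmeas n _) hfin] with μ hμ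
    have := tsum_ne_top_of_one_sub_expNeg
      (fun n => ENNReal.mul_ne_top ENNReal.coe_ne_top (hI n μ)) hμ.ne
    rw [pairing_eq_tsum_ceil μ.1 fun n => s (n - 1)]
    simpa using this

/-! ### Existence of the Lévy–Khintchine form -/

section Existence
variable {ρ : Measure BFMeasure}

lemma ae_pairing_ne_top_mono {f g : ℝ → ℝ≥0} (h : f ≤ g) (hg : ∀ᵐ μ ∂ρ, pairing μ.1 g ≠ ∞) :
    ∀ᵐ μ ∂ρ, pairing μ.1 f ≠ ∞ :=
  hg.mono fun _ hμ => ne_top_of_le_ne_top hμ (pairing_mono h)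

lemma ae_pairing_ne_top_add {f g : ℝ → ℝ≥0} (hf : Measurable f)
    (hf' : ∀ᵐ μ ∂ρ, pairing μ.1 f ≠ ∞) (hg' : ∀ᵐ μ ∂ρ, pairing μ.1 g ≠ ∞) :
    ∀ᵐ μ ∂ρ, pairing μ.1 (f + g) ≠ ∞ := by
  filter_upwards [hf', hg'] with μ h1 h2
  rw [pairing_add _ hf]
  exact ENNReal.add_ne_top.2 ⟨h1, h2⟩

variable [IsProbabilityMeasure ρ]

/-- One Λ, built from the single direction h, must serve every direction g; the exchange relation
between the increment measures of g and h ensures this. -/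
lemma exists_levyMeasure (hρ : IsInfDiv ρ) {h : ℝ → ℝ≥0} (hh : Measurable h)
    (hpos : ∀ x, 0 < h x) (hfin : ∀ᵐ μ ∂ρ, pairing μ.1 h ≠ ∞) :
    ∃ Λ : Measure BFMeasureStar, ∀ g, Measurable g → (∀ᵐ μ ∂ρ, pairing μ.1 g ≠ ∞) →
      ∃ a : ℝ≥0∞, ∀ f, Measurable f → logLap ρ (f + g) = logLap ρ f + a +
        ∫⁻ μ, expNeg (pairing μ.1.1 f) * (1 - expNeg (pairing μ.1.1 g)) ∂Λ := by
  obtain ⟨σ, hσ, hσK⟩ := exists_tilt hρ hh hfin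
  let w (μ : BFMeasure) : ℝ≥0∞ := 1 - expNeg (pairing μ.1 h)
  have hw : Measurable w := (measurable_expNeg_pairing hh).const_sub _
  let S : Set BFMeasure := {μ | μ.1 ≠ 0}
  have hS : MeasurableSet S := measurableSet_ne_zero
  have hw0 {μ : BFMeasure} (hμ : μ ∈ S) : w μ ≠ 0 :=
    mt one_sub_expNeg_eq_zero.1 (pairing_ne_zero hμ hh hpos)
  have hwtop (μ : BFMeasure) : w μ ≠ ∞ := ENNReal.sub_ne_top ENNReal.one_ne_top
  refine ⟨(σ.comap Subtype.val).withDensity fun μ => (w μ.1)⁻¹, fun g hg hgfin => ?_⟩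
  obtain ⟨τ, hτ, hτK⟩ := exists_tilt hρ hg hgfin
  let v (μ : BFMeasure) : ℝ≥0∞ := 1 - expNeg (pairing μ.1 g)
  have hv : Measurable v := (measurable_expNeg_pairing hg).const_sub _
  have hfinite {u : BFMeasure → ℝ≥0∞} (hu : ∀ μ, u μ ≤ 1) (κ : Measure BFMeasure)
      [IsFiniteMeasure κ] : IsFiniteMeasure (κ.withDensity u) :=
    isFiniteMeasure_withDensity
      (ne_top_of_le_ne_top (measure_ne_top κ Set.univ) ((lintegral_mono hu).trans (by simp)))
  have hw1 := hfinite (u := w) (fun μ => tsub_le_self) τ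
  have hv1 := hfinite (u := v) (fun μ => tsub_le_self) σ
  -- Both sides have as Laplace functional the same second difference of K in the directions g and
  -- h, which is symmetric in the two.
  have hexch : τ.withDensity w = σ.withDensity v := by
    refine ext_of_lap fun φ f hf => ?_
    rw [lap_withDensity_one_sub _ hf.measurable hh, lap_withDensity_one_sub _ hf.measurable hg]
    have e1 := hτK _ (hf.measurable.add hh)
    have e2 := hσK _ (hf.measurable.add hg)
    rw [hσK f hf.measurable] at e1
    rw [hτK f hf.measurable, add_right_comm, e1, add_assoc, add_assoc,
      ENNReal.add_right_inj (logLap_ne_top hf.measurable (Eventually.of_forall hf.ne_top))] at e2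
    have l1 := lap_ne_top τ (f + h)
    have l2 := lap_ne_top σ (f + g)
    rw [← ENNReal.add_sub_add_eq_sub_right l2 (a := lap τ f), ← e2, add_comm (lap τ (f + h)),
      ENNReal.add_sub_add_eq_sub_right l1]
  -- The constant is the mass of τ at the zero measure, where every exponential equals 1.
  refine ⟨τ Sᶜ, fun f hf => ?_⟩
  have hF : Measurable fun μ : BFMeasure => expNeg (pairing μ.1 f) := measurable_expNeg_pairing hf
  rw [hτK f hf, add_assoc]
  congr 1
  rw [lap, ← lintegral_add_compl _ hS, add_comm]
  congr 1
  · rw [← setLIntegral_one]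
    refine setLIntegral_congr_fun hS.compl fun μ hμ => ?_
    have : μ.1 = 0 := by simpa [S] using hμ
    simp [this]
  · calc ∫⁻ μ in S, expNeg (pairing μ.1 f) ∂τ
        = ∫⁻ μ in S, w μ * ((w μ)⁻¹ * expNeg (pairing μ.1 f)) ∂τ := by
          refine setLIntegral_congr_fun hS fun μ hμ => ?_
          rw [← mul_assoc, ENNReal.mul_inv_cancel (hw0 hμ) (hwtop μ), one_mul]
      _ = ∫⁻ μ in S, (w μ)⁻¹ * expNeg (pairing μ.1 f) ∂(τ.withDensity w) := by
          rw [restrict_withDensity hS, lintegral_withDensity_eq_lintegral_mul _ hw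
            (g := fun μ => (w μ)⁻¹ * expNeg (pairing μ.1 f)) (hw.inv.mul hF)]
          rfl
      _ = ∫⁻ μ in S, v μ * ((w μ)⁻¹ * expNeg (pairing μ.1 f)) ∂σ := by
          rw [hexch, restrict_withDensity hS,
            lintegral_withDensity_eq_lintegral_mul _ hv
              (g := fun μ => (w μ)⁻¹ * expNeg (pairing μ.1 f)) (hw.inv.mul hF)]
          rfl
      _ = _ := by
          have hwi : Measurable fun μ : BFMeasureStar => (w μ.1)⁻¹ :=
            hw.inv.comp measurable_subtype_coe
          rw [← lintegral_subtype_comap hS, lintegral_withDensity_eq_lintegral_mul _ hwi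
            (g := fun μ => expNeg (pairing μ.1.1 f) * (1 - expNeg (pairing μ.1.1 g)))
            ((measurable_star_expNeg hf).mul (measurable_star_one_sub hg))]
          refine lintegral_congr fun μ => ?_
          simp only [Pi.mul_apply, v]
          ring

/-- What is left of the cumulant when the contribution of the Lévy measure is removed. -/
def driftForm (ρ : Measure BFMeasure) (Λ : Measure BFMeasureStar) (f : ℝ → ℝ≥0) : ℝ≥0∞ :=
  logLap ρ f - levyForm Λ f

variable {Λ : Measure BFMeasureStar}

/-- Taking f = 0 in the increment formula identifies the constant a as the drift of g. -/
lemma driftForm_add_levyForm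
    (hΛ : ∀ g, Measurable g → (∀ᵐ μ ∂ρ, pairing μ.1 g ≠ ∞) →
      ∃ a : ℝ≥0∞, ∀ f, Measurable f → logLap ρ (f + g) = logLap ρ f + a +
        ∫⁻ μ, expNeg (pairing μ.1.1 f) * (1 - expNeg (pairing μ.1.1 g)) ∂Λ)
    {g : ℝ → ℝ≥0} (hg : Measurable g) (hg' : ∀ᵐ μ ∂ρ, pairing μ.1 g ≠ ∞) :
    levyForm Λ g ≠ ∞ ∧ logLap ρ g = driftForm ρ Λ g + levyForm Λ g ∧
      ∀ f, Measurable f → logLap ρ (f + g) = logLap ρ f + driftForm ρ Λ g +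
        ∫⁻ μ, expNeg (pairing μ.1.1 f) * (1 - expNeg (pairing μ.1.1 g)) ∂Λ := by
  obtain ⟨a, ha⟩ := hΛ g hg hg'
  have h0 := ha 0 measurable_const
  simp only [zero_add, logLap_zero, pairing_zero, expNeg_zero, one_mul] at h0
  change logLap ρ g = a + levyForm Λ g at h0
  have hfin : levyForm Λ g ≠ ∞ :=
    ne_top_of_le_ne_top (logLap_ne_top hg hg') (h0 ▸ le_add_self)
  have hd : driftForm ρ Λ g = a := by rw [driftForm, h0, ENNReal.add_sub_cancel_right hfin]
  rw [hd]
  exact ⟨hfin, h0, ha⟩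

lemma driftForm_add
    (hΛ : ∀ g, Measurable g → (∀ᵐ μ ∂ρ, pairing μ.1 g ≠ ∞) →
      ∃ a : ℝ≥0∞, ∀ f, Measurable f → logLap ρ (f + g) = logLap ρ f + a +
        ∫⁻ μ, expNeg (pairing μ.1.1 f) * (1 - expNeg (pairing μ.1.1 g)) ∂Λ)
    {f g : ℝ → ℝ≥0} (hf : Measurable f) (hf' : ∀ᵐ μ ∂ρ, pairing μ.1 f ≠ ∞)
    (hg : Measurable g) (hg' : ∀ᵐ μ ∂ρ, pairing μ.1 g ≠ ∞) :
    driftForm ρ Λ (f + g) = driftForm ρ Λ f + driftForm ρ Λ g := by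
  obtain ⟨-, h1, -⟩ := driftForm_add_levyForm hΛ hf hf'
  obtain ⟨-, -, h2⟩ := driftForm_add_levyForm hΛ hg hg'
  obtain ⟨h3, -, -⟩ := driftForm_add_levyForm hΛ (hf.add hg) (ae_pairing_ne_top_add hf hf' hg')
  have h4 : logLap ρ (f + g) = driftForm ρ Λ f + driftForm ρ Λ g + levyForm Λ (f + g) := by
    rw [h2 f hf, h1, levyForm_add Λ hf]; ring
  rw [driftForm, h4, ENNReal.add_sub_cancel_right h3]

lemma driftForm_zero : driftForm ρ Λ 0 = 0 := by
  rw [driftForm, logLap_zero, zero_tsub]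

lemma tendsto_indicator_tail {A : ℕ → Set ℝ} (hd : Pairwise (Function.onFun Disjoint A))
    (h : ℝ → ℝ≥0) (x : ℝ) :
    Tendsto (fun n => (⋃ i, A (i + n)).indicator h x) atTop (𝓝 0) := by
  refine tendsto_const_nhds.congr' ?_
  by_cases hx : ∃ j, x ∈ A j
  · obtain ⟨j, hj⟩ := hx
    filter_upwards [eventually_gt_atTop j] with n hn
    refine (Set.indicator_of_notMem (fun hmem => ?_) _).symm
    obtain ⟨i, hi⟩ := Set.mem_iUnion.1 hmem
    exact Set.disjoint_left.1 (hd (by omega : j ≠ i + n)) hj hi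
  · refine Eventually.of_forall fun n => (Set.indicator_of_notMem (fun hmem => ?_) _).symm
    obtain ⟨i, hi⟩ := Set.mem_iUnion.1 hmem
    exact hx ⟨_, hi⟩

/-- Finite additivity is `driftForm_add`. The remainder is at most the cumulant of h on the tail
sets, which tends to 0 by dominated convergence since ⟨μ, h⟩ is almost surely finite. -/
lemma driftForm_iUnion
    (hΛ : ∀ g, Measurable g → (∀ᵐ μ ∂ρ, pairing μ.1 g ≠ ∞) →
      ∃ a : ℝ≥0∞, ∀ f, Measurable f → logLap ρ (f + g) = logLap ρ f + a +
        ∫⁻ μ, expNeg (pairing μ.1.1 f) * (1 - expNeg (pairing μ.1.1 g)) ∂Λ)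
    {h : ℝ → ℝ≥0} (hh : Measurable h) (hfin : ∀ᵐ μ ∂ρ, pairing μ.1 h ≠ ∞)
    {A : ℕ → Set ℝ} (hA : ∀ i, MeasurableSet (A i)) (hd : Pairwise (Function.onFun Disjoint A)) :
    driftForm ρ Λ ((⋃ i, A i).indicator h) = ∑' i, driftForm ρ Λ ((A i).indicator h) := by
  have hle (B : Set ℝ) : B.indicator h ≤ h := Set.indicator_le_self' fun _ _ => zero_le
  let R (n : ℕ) : Set ℝ := ⋃ i, A (i + n)
  have hR (n : ℕ) : MeasurableSet (R n) := .iUnion fun i => hA _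
  have hstep (n : ℕ) : driftForm ρ Λ ((R n).indicator h) =
      driftForm ρ Λ ((A n).indicator h) + driftForm ρ Λ ((R (n + 1)).indicator h) := by
    have hU : R n = A n ∪ R (n + 1) := by
      ext x
      simp only [R, Set.mem_iUnion, Set.mem_union]
      constructor
      · rintro ⟨i, hi⟩
        rcases i with _ | i
        · exact Or.inl (by simpa using hi)
        · exact Or.inr ⟨i, by rwa [add_right_comm, add_assoc] at hi⟩
      · rintro (hx | ⟨i, hi⟩)
        · exact ⟨0, by simpa using hx⟩
        · exact ⟨i + 1, by rwa [add_right_comm, add_assoc]⟩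
    have hdis : Disjoint (A n) (R (n + 1)) :=
      Set.disjoint_iUnion_right.2 fun i => hd (by omega)
    rw [hU, Set.indicator_union_of_disjoint hdis]
    exact driftForm_add hΛ (hh.indicator (hA n)) (ae_pairing_ne_top_mono (hle _) hfin)
      (hh.indicator (hR _)) (ae_pairing_ne_top_mono (hle _) hfin)
  have hsum (n : ℕ) : driftForm ρ Λ ((⋃ i, A i).indicator h) =
      ∑ i ∈ Finset.range n, driftForm ρ Λ ((A i).indicator h) +
        driftForm ρ Λ ((R n).indicator h) := by
    induction n with
    | zero => simp [R]
    | succ n ih => rw [ih, hstep, Finset.sum_range_succ, add_assoc]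
  have hlim : Tendsto (fun n => driftForm ρ Λ ((R n).indicator h)) atTop (𝓝 0) := by
    have : Tendsto (fun n => logLap ρ ((R n).indicator h)) atTop (𝓝 (logLap ρ 0)) :=
      tendsto_logLap (fun n => hh.indicator (hR n)) (hfin.mono fun μ hμ =>
        tendsto_pairing_of_dominated (fun n => hh.indicator (hR n)) (fun n => hle _) hμ
          fun x => tendsto_indicator_tail hd h x)
    rw [logLap_zero] at this
    exact tendsto_of_tendsto_of_tendsto_of_le_of_le tendsto_const_nhds this
      (fun _ => zero_le) fun _ => tsub_le_self
  have h1 := ENNReal.summable.hasSum.tendsto_sum_nat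
    (f := fun i => driftForm ρ Λ ((A i).indicator h))
  have h2 := h1.add hlim
  rw [add_zero] at h2
  exact tendsto_nhds_unique (tendsto_const_nhds.congr hsum) h2

/-- The cumulant of an infinitely divisible random measure has a Lévy–Khintchine form. -/
theorem exists_lkForm (hρ : IsInfDiv ρ) :
    ∃ (l : Measure ℝ) (Λ : Measure BFMeasureStar),
      ∀ f, Measurable f → logLap ρ f = lkForm l Λ f := by
  obtain ⟨h, hh, hpos, hfin⟩ := exists_pos_pairing_ne_top ρ
  obtain ⟨Λ, hΛ⟩ := exists_levyMeasure hρ hh hpos hfin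
  -- This is the drift weighted by h: the weight keeps all cumulants finite, and it is divided out
  -- below to give l.
  let m : Measure ℝ := Measure.ofMeasurable (fun A _ => driftForm ρ Λ (A.indicator h))
    (by rw [Set.indicator_empty']; exact driftForm_zero) (fun A hA hd => driftForm_iUnion hΛ hh hfin hA hd)
  have hm {A : Set ℝ} (hA : MeasurableSet A) : m A = driftForm ρ Λ (A.indicator h) :=
    Measure.ofMeasurable_apply A hA
  have hmulfin {f : ℝ → ℝ≥0} {c : ℝ≥0} (hf : ∀ x, f x ≤ c) :
      ∀ᵐ μ ∂ρ, pairing μ.1 (h * f) ≠ ∞ := by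
    filter_upwards [hfin] with μ hμ
    refine ne_top_of_le_ne_top (b := pairing μ.1 fun x => c * h x) ?_ (pairing_mono fun x => ?_)
    · rw [pairing_const_mul _ hh]
      exact ENNReal.mul_ne_top ENNReal.coe_ne_top hμ
    · simp only [Pi.mul_apply]
      rw [mul_comm]
      gcongr
      exact hf x
  have hbdd (s : SimpleFunc ℝ ℝ≥0) : ∃ c, ∀ x, s x ≤ c := by
    obtain ⟨c, hc⟩ := s.finite_range.bddAbove
    exact ⟨c, fun x => hc ⟨x, rfl⟩⟩
  have hsimple (s : SimpleFunc ℝ ℝ≥0) : driftForm ρ Λ (h * s) = ∫⁻ x, s x ∂m := by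
    induction s using SimpleFunc.induction with
    | const c hA =>
      rename_i A
      have hadd (s t : ℝ≥0) : driftForm ρ Λ (h * A.indicator fun _ => s + t) =
          driftForm ρ Λ (h * A.indicator fun _ => s) + driftForm ρ Λ (h * A.indicator fun _ => t) := by
        have hb (s : ℝ≥0) (x : ℝ) : A.indicator (fun _ => s) x ≤ s :=
          Set.indicator_le_self' (fun _ _ => zero_le) x
        rw [← driftForm_add hΛ (hh.mul (measurable_const.indicator hA)) (hmulfin (hb s))
          (hh.mul (measurable_const.indicator hA)) (hmulfin (hb t)), ← mul_add,
          ← Set.indicator_add']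
        rfl
      -- Homogeneity in the constant is not part of additivity; it comes from Cauchy's equation.
      have h1 := eq_mul_of_additive (φ := fun s => driftForm ρ Λ (h * A.indicator fun _ => s))
        (by simp only [Set.indicator_zero]; exact (mul_zero h).symm ▸ driftForm_zero) hadd c
      have h2 : (h * A.indicator fun _ => (1 : ℝ≥0)) = A.indicator h := by
        ext x; by_cases hx : x ∈ A <;> simp [hx]
      simp only [h2] at h1
      rw [← hm hA] at h1
      have h3 : ⇑(SimpleFunc.piecewise A hA (SimpleFunc.const ℝ c) (SimpleFunc.const ℝ 0))
          = A.indicator fun _ => c := by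
        ext x; by_cases hx : x ∈ A <;> simp [hx]
      rw [h3, h1, ← pairing_indicator m hA c]
      rfl
    | add hdis h1 h2 =>
      rename_i f g
      obtain ⟨c, hc⟩ := hbdd f
      obtain ⟨d, hd⟩ := hbdd g
      rw [SimpleFunc.coe_add, mul_add, driftForm_add hΛ (hh.mul f.measurable) (hmulfin hc)
        (hh.mul g.measurable) (hmulfin hd), h1, h2]
      exact (pairing_add m f.measurable).symm
  let l : Measure ℝ := m.withDensity fun x => (h x : ℝ≥0∞)⁻¹
  have hl {f : ℝ → ℝ≥0} (hf : Measurable f) : pairing l (h * f) = pairing m f := by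
    have hi : Measurable fun x => (h x : ℝ≥0∞)⁻¹ := hh.coe_nnreal_ennreal.inv
    rw [pairing, lintegral_withDensity_eq_lintegral_mul _ hi
      (g := fun x => (((h * f) x : ℝ≥0) : ℝ≥0∞)) (hh.mul hf).coe_nnreal_ennreal]
    refine lintegral_congr fun x => ?_
    simp only [Pi.mul_apply, ENNReal.coe_mul]
    rw [← mul_assoc, ENNReal.inv_mul_cancel (ENNReal.coe_ne_zero.2 (hpos x).ne')
      ENNReal.coe_ne_top, one_mul]
  refine ⟨l, Λ, fun f hf => ?_⟩
  -- Write f = h (f / h) and approximate f / h from below by simple functions. These are bounded, so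
  -- the drift formula applies to h times each of them, and both sides pass to monotone limits.
  let q : ℝ → ℝ≥0∞ := fun x => ((f x / h x : ℝ≥0) : ℝ≥0∞)
  have hq : Measurable q := (hf.div hh).coe_nnreal_ennreal
  let s (n : ℕ) : SimpleFunc ℝ ℝ≥0 := (SimpleFunc.eapprox q n).map ENNReal.toNNReal
  have hs (n : ℕ) (x : ℝ) : ((s n x : ℝ≥0) : ℝ≥0∞) = SimpleFunc.eapprox q n x :=
    ENNReal.coe_toNNReal (SimpleFunc.eapprox_lt_top q n x).ne
  have hmono : Monotone fun n => h * ⇑(s n) := fun i j hij x => by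
    refine mul_le_mul_right ?_ _
    rw [← ENNReal.coe_le_coe, hs, hs]
    exact SimpleFunc.monotone_eapprox q hij x
  have hlim (x : ℝ) : Tendsto (fun n => (h * ⇑(s n)) x) atTop (𝓝 (f x)) := by
    have h1 : Tendsto (fun n => s n x) atTop (𝓝 (f x / h x)) := by
      rw [← ENNReal.tendsto_coe]
      simp only [hs]
      exact SimpleFunc.tendsto_eapprox hq x
    have h2 := h1.const_mul (h x)
    rwa [mul_div_cancel₀ _ (hpos x).ne'] at h2
  have hmeas (n : ℕ) : Measurable (h * ⇑(s n)) := hh.mul (s n).measurable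
  refine tendsto_nhds_unique
    (tendsto_logLap hmeas (Eventually.of_forall fun μ => tendsto_pairing_of_monotone hmeas hmono hlim))
    (((tendsto_pairing_of_monotone (μ := l) hmeas hmono hlim).add
      (tendsto_levyForm (Λ := Λ) hmeas hmono hlim)).congr fun n => ?_)
  obtain ⟨c, hc⟩ := hbdd (s n)
  rw [(driftForm_add_levyForm hΛ (hmeas n) (hmulfin hc)).2.1, hsimple, hl (s n).measurable]
  rfl
end Existence

/-! ### Translations -/

/-- The restriction of a boundedly finite measure `μ` to `[-k, k]`, provided `μ [-k, k] ≤ j`. -/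
def truncKernel (k j : ℕ) : Kernel BFMeasure ℝ :=
  Kernel.piecewise (s := {μ : BFMeasure | μ.1 (Set.Icc (-(k : ℝ)) k) ≤ j})
    (measurableSet_le (measurable_eval measurableSet_Icc) measurable_const)
    (Kernel.restrict ⟨fun μ => μ.1, measurable_subtype_coe⟩
      (measurableSet_Icc (a := -(k : ℝ)) (b := k))) 0

lemma truncKernel_apply_of_le {k j : ℕ} {μ : BFMeasure} (h : μ.1 (Set.Icc (-(k : ℝ)) k) ≤ j) :
    truncKernel k j μ = μ.1.restrict (Set.Icc (-(k : ℝ)) k) := by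
  rw [truncKernel, Kernel.piecewise_apply, if_pos (by exact h), Kernel.restrict_apply]
  rfl

lemma truncKernel_apply_of_not_le {k j : ℕ} {μ : BFMeasure}
    (h : ¬ μ.1 (Set.Icc (-(k : ℝ)) k) ≤ j) : truncKernel k j μ = 0 := by
  rw [truncKernel, Kernel.piecewise_apply, if_neg (by exact h)]
  rfl

instance (k j : ℕ) : IsFiniteKernel (truncKernel k j) := by
  refine ⟨⟨j, ENNReal.natCast_lt_top j, fun μ => ?_⟩⟩
  by_cases h : μ.1 (Set.Icc (-(k : ℝ)) k) ≤ j
  · rwa [truncKernel_apply_of_le h, Measure.restrict_apply_univ]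
  · simp [truncKernel_apply_of_not_le h]

/-- Presents μ ↦ μ as a supremum of finite kernels, for which measurability of sections is
available; joint measurability of translation rests on this. -/
lemma eval_eq_iSup_truncKernel (μ : BFMeasure) {A : Set ℝ} (hA : MeasurableSet A) :
    μ.1 A = ⨆ k : ℕ, ⨆ j : ℕ, truncKernel k j μ A := by
  have hj (k : ℕ) : ⨆ j : ℕ, truncKernel k j μ A = μ.1.restrict (Set.Icc (-(k : ℝ)) k) A := by
    refine le_antisymm (iSup_le fun j => ?_) ?_
    · by_cases h : μ.1 (Set.Icc (-(k : ℝ)) k) ≤ j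
      · rw [truncKernel_apply_of_le h]
      · simp [truncKernel_apply_of_not_le h]
    · obtain ⟨j, hj⟩ := ENNReal.exists_nat_gt
        (μ.2 _ measurableSet_Icc (Metric.isBounded_Icc (-(k : ℝ)) k)).ne
      exact le_iSup_of_le j (by rw [truncKernel_apply_of_le hj.le])
  have hU : A = ⋃ k : ℕ, A ∩ Set.Icc (-(k : ℝ)) k := by
    rw [← Set.inter_iUnion, eq_comm, Set.inter_eq_left]
    intro x _
    obtain ⟨k, hk⟩ := exists_nat_ge |x|
    exact Set.mem_iUnion.2 ⟨k, abs_le.1 hk⟩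
  simp only [hj, Measure.restrict_apply hA]
  conv_lhs => rw [hU]
  refine Monotone.measure_iUnion fun m n hmn => ?_
  have : (m : ℝ) ≤ n := by exact_mod_cast hmn
  exact Set.inter_subset_inter_right _ (Set.Icc_subset_Icc (neg_le_neg this) this)

lemma measurable_eval_prodMk {t : Set ((ℝ × BFMeasure) × ℝ)} (ht : MeasurableSet t) :
    Measurable fun p : ℝ × BFMeasure => p.2.1 (Prod.mk p ⁻¹' t) := by
  simp only [eval_eq_iSup_truncKernel _ (measurable_prodMk_left ht)]
  exact .iSup fun k => .iSup fun j =>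
    Kernel.measurable_kernel_prodMk_left (κ := Kernel.prodMkLeft ℝ (truncKernel k j)) ht

lemma measurable_translate :
    Measurable fun p : ℝ × BFMeasure => p.2.translate p.1 := by
  refine Measurable.subtype_mk (f := fun p : ℝ × BFMeasure => p.2.1.map fun y => y + p.1) ?_
  refine Measure.measurable_of_measurable_coe _ fun A hA => ?_
  have h (p : ℝ × BFMeasure) : (p.2.1.map fun y => y + p.1) A =
      p.2.1 (Prod.mk p ⁻¹' {q : (ℝ × BFMeasure) × ℝ | q.2 + q.1.1 ∈ A}) :=
    Measure.map_apply (measurable_id.add_const p.1) hA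
  simp only [h]
  exact measurable_eval_prodMk
    ((measurable_snd.add (measurable_fst.comp measurable_fst)) hA)

lemma measurable_star_translate :
    Measurable fun p : ℝ × BFMeasureStar => p.2.translate p.1 :=
  Measurable.subtype_mk (f := fun p : ℝ × BFMeasureStar => p.2.1.translate p.1)
    (measurable_translate.comp (measurable_fst.prodMk (measurable_subtype_coe.comp measurable_snd)))

lemma measurable_star_translate_const (x : ℝ) : Measurable (BFMeasureStar.translate x) :=
  measurable_star_translate.comp (measurable_const.prodMk measurable_id)

lemma measurable_translate_const (x : ℝ) : Measurable (BFMeasure.translate x) :=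
  measurable_translate.comp (measurable_const.prodMk measurable_id)

lemma translate_apply (x : ℝ) (μ : BFMeasureStar) {A : Set ℝ} (hA : MeasurableSet A) :
    (μ.translate x).1.1 A = μ.1.1 ((fun y => y + x) ⁻¹' A) :=
  Measure.map_apply (measurable_id.add_const x) hA

lemma translate_translate (x y : ℝ) (μ : BFMeasureStar) :
    (μ.translate y).translate x = μ.translate (y + x) := by
  refine Subtype.ext (Subtype.ext ?_)
  change Measure.map _ (Measure.map _ _) = Measure.map _ _
  rw [Measure.map_map (by fun_prop) (by fun_prop)]
  congr 1
  ext z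
  simp [add_assoc]

lemma translate_zero (μ : BFMeasureStar) : μ.translate 0 = μ := by
  refine Subtype.ext (Subtype.ext ?_)
  change Measure.map _ _ = _
  simp

/-! ### The position of the right end -/

lemma rightPosition_lt_iff {μ : BFMeasureStar} {t : EReal} :
    rightPosition μ < t ↔
      ∃ z : ℝ, (z : EReal) < t ∧ μ.1.1 (Set.Ioi z) < min 1 (μ.1.1 Set.univ / 2) := by
  rw [rightPosition, sInf_lt_iff]
  constructor
  · rintro ⟨_, ⟨z, rfl, hz⟩, hzt⟩
    exact ⟨z, hzt, hz⟩
  · rintro ⟨z, hzt, hz⟩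
    exact ⟨z, ⟨z, rfl, hz⟩, hzt⟩

/-- Translation leaves the total mass, hence the threshold min(1, μ(ℝ)/2), unchanged and only moves
the half-lines. This covariance makes {M = 0} a section of the orbits with finite M. -/
lemma rightPosition_translate (x : ℝ) (μ : BFMeasureStar) :
    rightPosition (μ.translate x) = rightPosition μ + x := by
  have hb : (x : EReal) ≠ ⊥ := EReal.coe_ne_bot x
  have ht : (x : EReal) ≠ ⊤ := EReal.coe_ne_top x
  refine eq_of_forall_gt_iff fun t => ?_
  rw [← EReal.lt_sub_iff_add_lt (Or.inl hb) (Or.inl ht), rightPosition_lt_iff, rightPosition_lt_iff]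
  have hcond (z : ℝ) : (μ.translate x).1.1 (Set.Ioi z) = μ.1.1 (Set.Ioi (z - x)) := by
    rw [translate_apply x μ measurableSet_Ioi]
    congr 1; ext y; simp [sub_lt_iff_lt_add]
  simp only [hcond, translate_apply x μ .univ, Set.preimage_univ]
  constructor
  · rintro ⟨z, hz, h⟩
    refine ⟨z - x, ?_, h⟩
    rw [EReal.lt_sub_iff_add_lt (Or.inl hb) (Or.inl ht), ← EReal.coe_add, sub_add_cancel]
    exact hz
  · rintro ⟨z, hz, h⟩
    refine ⟨z + x, ?_, by rwa [add_sub_cancel_right]⟩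
    rw [EReal.lt_sub_iff_add_lt (Or.inl hb) (Or.inl ht)] at hz
    exact_mod_cast hz

/-- Since μ((z, ∞)) decreases in z, rational z suffice. -/
lemma measurable_rightPosition : Measurable rightPosition := by
  refine measurable_of_Iio fun t => ?_
  have h : rightPosition ⁻¹' Set.Iio t = ⋃ q : ℚ, {μ : BFMeasureStar |
      ((q : ℝ) : EReal) < t ∧ μ.1.1 (Set.Ioi (q : ℝ)) < min 1 (μ.1.1 Set.univ / 2)} := by
    ext μ
    simp only [Set.mem_preimage, Set.mem_Iio, Set.mem_iUnion]
    rw [rightPosition_lt_iff]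
    constructor
    · rintro ⟨z, hz, h⟩
      obtain ⟨q, hq1, hq2⟩ := EReal.exists_rat_btwn_of_lt hz
      exact ⟨q, hq2, (measure_mono (Set.Ioi_subset_Ioi (by exact_mod_cast hq1.le))).trans_lt h⟩
    · rintro ⟨q, hq, h⟩
      exact ⟨q, hq, h⟩
  rw [h]
  refine .iUnion fun q => ?_
  have hev {A : Set ℝ} (hA : MeasurableSet A) : Measurable fun μ : BFMeasureStar => μ.1.1 A :=
    (measurable_eval hA).comp measurable_subtype_coe
  exact .inter (.const _) (measurableSet_lt (hev measurableSet_Ioi)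
    (measurable_const.min ((hev .univ).div_const 2)))

/-- The threshold is strictly below the total mass of a nonzero measure, and μ((-n, ∞)) increases to
that mass. -/
lemma rightPosition_ne_bot (μ : BFMeasureStar) : rightPosition μ ≠ ⊥ := by
  have hlim : Tendsto (fun n : ℕ => μ.1.1 (Set.Ioi (-(n : ℝ)))) atTop (𝓝 (μ.1.1 Set.univ)) := by
    have hU : ⋃ n : ℕ, Set.Ioi (-(n : ℝ)) = Set.univ := by
      refine Set.eq_univ_of_forall fun x => ?_
      obtain ⟨n, hn⟩ := exists_nat_gt (-x)
      exact Set.mem_iUnion.2 ⟨n, by simpa using neg_lt.1 hn⟩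
    rw [← hU]
    refine tendsto_measure_iUnion_atTop fun m n hmn => Set.Ioi_subset_Ioi ?_
    have : (m : ℝ) ≤ n := by exact_mod_cast hmn
    linarith
  have hpos : μ.1.1 Set.univ ≠ 0 := by simpa using μ.2
  have hlt : min 1 (μ.1.1 Set.univ / 2) < μ.1.1 Set.univ := by
    by_cases h : μ.1.1 Set.univ = ∞
    · simp [h]
    · exact (min_le_right _ _).trans_lt (ENNReal.half_lt_self hpos h)
  obtain ⟨n, hn⟩ := (hlim.eventually (lt_mem_nhds hlt)).exists
  intro hbot
  have : rightPosition μ < ((-(n : ℝ) : ℝ) : EReal) := by rw [hbot]; exact EReal.bot_lt_coe _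
  obtain ⟨z, hz, h⟩ := rightPosition_lt_iff.1 this
  exact (hn.trans_le (measure_mono (Set.Ioi_subset_Ioi (EReal.coe_lt_coe_iff.1 hz).le))).not_gt h

lemma rightPosition_ne_top {μ : BFMeasureStar} (h : μ.1.1 (Set.Ioi 0) ≠ ∞) :
    rightPosition μ ≠ ⊤ := by
  have hlim : Tendsto (fun n : ℕ => μ.1.1 (Set.Ioi (n : ℝ))) atTop (𝓝 0) := by
    have hI : ⋂ n : ℕ, Set.Ioi (n : ℝ) = ∅ := by
      refine Set.eq_empty_of_forall_notMem fun x hx => ?_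
      obtain ⟨n, hn⟩ := exists_nat_gt x
      exact (hn.trans (Set.mem_iInter.1 hx n)).false
    rw [← measure_empty (μ := μ.1.1), ← hI]
    exact tendsto_measure_iInter_atTop (fun n => measurableSet_Ioi.nullMeasurableSet)
      (fun m n hmn => Set.Ioi_subset_Ioi (by exact_mod_cast hmn)) ⟨0, by simpa using h⟩
  have hpos : μ.1.1 Set.univ ≠ 0 := by simpa using μ.2
  have hlt : 0 < min 1 (μ.1.1 Set.univ / 2) :=
    lt_min one_pos (ENNReal.div_pos hpos ENNReal.ofNat_ne_top)
  obtain ⟨n, hn⟩ := (hlim.eventually (gt_mem_nhds hlt)).exists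
  exact (rightPosition_lt_iff.2 ⟨n, EReal.coe_lt_top _, hn⟩).ne

/-! ### Translation-covariant measures and their sections -/

/-- The measure `∫ e^{-x} T_x Δ dx`. -/
def flow (Δ : Measure BFMeasureStar) : Measure BFMeasureStar :=
  (((volume : Measure ℝ).withDensity fun x => ENNReal.ofReal (Real.exp (-x))).prod Δ).map
    fun p => p.2.translate p.1

/-- The part of a measure which is carried by `{0 ≤ M < 1}`, weighted by `e^M` and moved to
`{M = 0}`. -/
def unflow (Λ : Measure BFMeasureStar) : Measure BFMeasureStar :=
  ((Λ.restrict {μ | 0 ≤ rightPosition μ ∧ rightPosition μ < 1}).withDensity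
    fun μ => ENNReal.ofReal (Real.exp (rightPosition μ).toReal)).map
      fun μ => μ.translate (-(rightPosition μ).toReal)

lemma measurable_ofReal_exp_neg : Measurable fun x : ℝ => ENNReal.ofReal (Real.exp (-x)) :=
  (Real.measurable_exp.comp measurable_neg).ennreal_ofReal

lemma lintegral_flow (Δ : Measure BFMeasureStar) [SFinite Δ] {F : BFMeasureStar → ℝ≥0∞}
    (hF : Measurable F) : ∫⁻ μ, F μ ∂(flow Δ) =
      ∫⁻ x : ℝ, ENNReal.ofReal (Real.exp (-x)) * ∫⁻ μ, F (μ.translate x) ∂Δ := by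
  have hm : Measurable fun p : ℝ × BFMeasureStar => F (p.2.translate p.1) :=
    hF.comp measurable_star_translate
  rw [flow, lintegral_map hF measurable_star_translate, lintegral_prod _ hm.aemeasurable,
    lintegral_withDensity_eq_lintegral_mul _ measurable_ofReal_exp_neg hm.lintegral_prod_right']
  rfl

lemma measurable_toReal_rightPosition :
    Measurable fun μ : BFMeasureStar => (rightPosition μ).toReal :=
  measurable_ereal_toReal.comp measurable_rightPosition

lemma measurable_center :
    Measurable fun μ : BFMeasureStar => μ.translate (-(rightPosition μ).toReal) :=
  measurable_star_translate.comp (measurable_toReal_rightPosition.neg.prodMk measurable_id)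

lemma measurable_exp_rightPosition :
    Measurable fun μ : BFMeasureStar => ENNReal.ofReal (Real.exp (rightPosition μ).toReal) :=
  (Real.measurable_exp.comp measurable_toReal_rightPosition).ennreal_ofReal

lemma measurableSet_rightPosition_mem (a b : EReal) :
    MeasurableSet {μ : BFMeasureStar | a ≤ rightPosition μ ∧ rightPosition μ < b} :=
  measurable_rightPosition measurableSet_Ico

lemma lintegral_unflow (Λ : Measure BFMeasureStar) {F : BFMeasureStar → ℝ≥0∞}
    (hF : Measurable F) : ∫⁻ μ, F μ ∂(unflow Λ) =
      ∫⁻ μ in {μ | 0 ≤ rightPosition μ ∧ rightPosition μ < 1},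
        ENNReal.ofReal (Real.exp (rightPosition μ).toReal) *
          F (μ.translate (-(rightPosition μ).toReal)) ∂Λ := by
  rw [unflow, lintegral_map hF measurable_center,
    lintegral_withDensity_eq_lintegral_mul _ measurable_exp_rightPosition
      (g := fun μ => F (μ.translate (-(rightPosition μ).toReal))) (hF.comp measurable_center)]
  rfl

instance (Λ : Measure BFMeasureStar) [SFinite Λ] : SFinite (unflow Λ) := by
  unfold unflow; infer_instance

lemma unflow_rightPosition_ne_zero (Λ : Measure BFMeasureStar) :
    unflow Λ {μ | rightPosition μ ≠ 0} = 0 := by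
  have hs : MeasurableSet {μ : BFMeasureStar | rightPosition μ ≠ 0} :=
    (measurable_rightPosition (measurableSet_singleton 0)).compl
  rw [← lintegral_indicator_one hs, lintegral_unflow Λ (measurable_one.indicator hs)]
  rw [← lintegral_zero (μ := Λ.restrict {μ | 0 ≤ rightPosition μ ∧ rightPosition μ < 1})]
  refine setLIntegral_congr_fun (measurableSet_rightPosition_mem 0 1) fun μ hμ => ?_
  have h1 : rightPosition μ ≠ ⊤ := (hμ.2.trans_le le_top).ne
  have h2 : rightPosition (μ.translate (-(rightPosition μ).toReal)) = 0 := by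
    rw [rightPosition_translate]
    lift rightPosition μ to ℝ using ⟨h1, rightPosition_ne_bot μ⟩ with r
    rw [EReal.toReal_coe, ← EReal.coe_add, add_neg_cancel, EReal.coe_zero]
  simp [h2]

lemma ofReal_exp_mul_exp_neg (x : ℝ) :
    ENNReal.ofReal (Real.exp x) * ENNReal.ofReal (Real.exp (-x)) = 1 := by
  rw [← ENNReal.ofReal_mul (Real.exp_pos _).le, ← Real.exp_add]; simp

/-- If M(μ) = 0 then M(T_x μ) = x, so restricting to {0 ≤ M < 1} keeps exactly x in [0, 1). The
weight e^M cancels e^{-x}, recentring undoes T_x, and the interval has length 1. -/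
theorem unflow_flow (Δ : Measure BFMeasureStar) [SFinite Δ]
    (h : Δ {μ | rightPosition μ ≠ 0} = 0) : unflow (flow Δ) = Δ := by
  refine Measure.ext_of_lintegral _ fun F hF => ?_
  have hB := measurableSet_rightPosition_mem 0 1
  have hG : Measurable fun μ : BFMeasureStar => ENNReal.ofReal (Real.exp (rightPosition μ).toReal) *
      F (μ.translate (-(rightPosition μ).toReal)) :=
    measurable_exp_rightPosition.mul (hF.comp measurable_center)
  rw [lintegral_unflow _ hF, ← lintegral_indicator hB, lintegral_flow Δ (hG.indicator hB)]
  have hx (x : ℝ) : ENNReal.ofReal (Real.exp (-x)) * ∫⁻ μ,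
      ({μ : BFMeasureStar | 0 ≤ rightPosition μ ∧ rightPosition μ < 1}.indicator
        (fun μ => ENNReal.ofReal (Real.exp (rightPosition μ).toReal) *
          F (μ.translate (-(rightPosition μ).toReal)))) (μ.translate x) ∂Δ =
      (Set.Ico (0 : ℝ) 1).indicator (fun _ => ∫⁻ μ, F μ ∂Δ) x := by
    have hae : ∀ᵐ μ ∂Δ, rightPosition (μ.translate x) = x := by
      refine (show ∀ᵐ μ ∂Δ, rightPosition μ = 0 from h).mono fun μ hμ => ?_
      rw [rightPosition_translate, hμ, zero_add]
    by_cases hx : x ∈ Set.Ico (0 : ℝ) 1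
    · rw [Set.indicator_of_mem hx, ← lintegral_const_mul' _ _ ENNReal.ofReal_ne_top]
      refine lintegral_congr_ae (hae.mono fun μ hμ => ?_)
      have hmem : μ.translate x ∈
          {μ : BFMeasureStar | 0 ≤ rightPosition μ ∧ rightPosition μ < 1} := by
        simp only [Set.mem_ofPred_eq, hμ]
        exact_mod_cast hx
      simp only [Set.indicator_of_mem hmem, hμ, EReal.toReal_coe, translate_translate,
        add_neg_cancel, translate_zero]
      rw [← mul_assoc, mul_comm (ENNReal.ofReal _), ofReal_exp_mul_exp_neg, one_mul]
    · rw [Set.indicator_of_notMem hx]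
      refine mul_eq_zero_of_right _ ?_
      rw [← lintegral_zero (μ := Δ)]
      refine lintegral_congr_ae (hae.mono fun μ hμ => ?_)
      refine Set.indicator_of_notMem (fun hmem => hx ?_) _
      simp only [Set.mem_ofPred_eq, hμ] at hmem
      exact_mod_cast hmem
  simp only [hx]
  rw [lintegral_indicator measurableSet_Ico]
  simp

/-- After Tonelli and the substitution y = x - M(μ), the scaling of Λ moves T_y from the integrand
to the window, which becomes {y ≤ M < y + 1}. For finite M(ν) the admissible y form an interval of
length 1; orbits with M = ∞ would be lost, whence `hfin`. -/
theorem flow_unflow (Λ : Measure BFMeasureStar) [SFinite Λ]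
    (hscale : ∀ (x : ℝ) (F : BFMeasureStar → ℝ≥0∞), Measurable F →
      ∫⁻ μ, F (μ.translate x) ∂Λ = ENNReal.ofReal (Real.exp x) * ∫⁻ μ, F μ ∂Λ)
    (hfin : ∀ᵐ μ ∂Λ, rightPosition μ ≠ ⊤) : flow (unflow Λ) = Λ := by
  refine Measure.ext_of_lintegral _ fun F hF => ?_
  have hFT : Measurable fun p : ℝ × BFMeasureStar => F (p.2.translate p.1) :=
    hF.comp measurable_star_translate
  let B : Set BFMeasureStar := {μ | 0 ≤ rightPosition μ ∧ rightPosition μ < 1}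
  have hB : MeasurableSet B := measurableSet_rightPosition_mem 0 1
  have hcenter : Measurable fun p : ℝ × BFMeasureStar =>
      p.2.translate (p.1 - (rightPosition p.2).toReal) :=
    measurable_star_translate.comp
      ((measurable_fst.sub (measurable_toReal_rightPosition.comp measurable_snd)).prodMk
        measurable_snd)
  have hexp : Measurable fun p : ℝ × BFMeasureStar =>
      ENNReal.ofReal (Real.exp (-(p.1 - (rightPosition p.2).toReal))) :=
    measurable_ofReal_exp_neg.comp
      (measurable_fst.sub (measurable_toReal_rightPosition.comp measurable_snd))
  have hset : MeasurableSet {p : ℝ × BFMeasureStar |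
      (p.1 : EReal) ≤ rightPosition p.2 ∧ rightPosition p.2 < p.1 + 1} :=
    .inter (measurableSet_le (measurable_coe_real_ereal.comp measurable_fst)
        (measurable_rightPosition.comp measurable_snd))
      (measurableSet_lt (measurable_rightPosition.comp measurable_snd)
        ((measurable_coe_real_ereal.comp measurable_fst).add measurable_const))
  let H (y : ℝ) (ν : BFMeasureStar) : ℝ≥0∞ :=
    {p : ℝ × BFMeasureStar | (p.1 : EReal) ≤ rightPosition p.2 ∧
      rightPosition p.2 < p.1 + 1}.indicator (fun p => F p.2) (y, ν)
  have hH : Measurable (Function.uncurry H) := (hF.comp measurable_snd).indicator hset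
  have hHT (y : ℝ) (μ : BFMeasureStar) :
      B.indicator (fun μ => F (μ.translate y)) μ = H y (μ.translate y) := by
    have hiff : (0 ≤ rightPosition μ ∧ rightPosition μ < 1) ↔
        ((y : EReal) ≤ rightPosition μ + y ∧ rightPosition μ + y < y + 1) := by
      rcases eq_or_ne (rightPosition μ) ⊤ with h | h
      · simp [h]
      · lift rightPosition μ to ℝ using ⟨h, rightPosition_ne_bot μ⟩ with r
        norm_cast
        constructor <;> rintro ⟨h1, h2⟩ <;> constructor <;> linarith
    simp only [H, Set.indicator, B, Set.mem_ofPred_eq, rightPosition_translate, hiff]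
  calc ∫⁻ μ, F μ ∂(flow (unflow Λ))
      = ∫⁻ x : ℝ, ∫⁻ μ in B, ENNReal.ofReal (Real.exp (-(x - (rightPosition μ).toReal))) *
          F (μ.translate (x - (rightPosition μ).toReal)) ∂Λ := by
        rw [lintegral_flow _ hF]
        refine lintegral_congr fun x => ?_
        rw [lintegral_unflow Λ (F := fun μ => F (μ.translate x))
          (hF.comp (measurable_star_translate_const x)),
          ← lintegral_const_mul' _ _ ENNReal.ofReal_ne_top]
        refine lintegral_congr fun μ => ?_
        rw [translate_translate, ← mul_assoc, ← ENNReal.ofReal_mul (Real.exp_pos _).le,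
          ← Real.exp_add, neg_sub, neg_add_eq_sub, neg_add_eq_sub]
    _ = ∫⁻ μ in B, (∫⁻ x : ℝ, ENNReal.ofReal (Real.exp (-(x - (rightPosition μ).toReal))) *
          F (μ.translate (x - (rightPosition μ).toReal))) ∂Λ :=
        lintegral_lintegral_swap (hexp.mul (hF.comp hcenter)).aemeasurable
    _ = ∫⁻ μ in B, (∫⁻ y : ℝ, ENNReal.ofReal (Real.exp (-y)) * F (μ.translate y)) ∂Λ := by
        refine lintegral_congr fun μ => ?_
        exact lintegral_sub_right_eq_self
          (fun y => ENNReal.ofReal (Real.exp (-y)) * F (μ.translate y)) _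
    _ = ∫⁻ y : ℝ, ∫⁻ μ in B, ENNReal.ofReal (Real.exp (-y)) * F (μ.translate y) ∂Λ := by
        refine (lintegral_lintegral_swap ?_).symm
        exact ((measurable_ofReal_exp_neg.comp measurable_fst).mul hFT).aemeasurable
    _ = ∫⁻ y : ℝ, ∫⁻ ν, H y ν ∂Λ := by
        refine lintegral_congr fun y => ?_
        rw [lintegral_const_mul' _ _ ENNReal.ofReal_ne_top, ← lintegral_indicator hB]
        simp only [hHT]
        rw [hscale y (H y) (hH.comp measurable_prodMk_left), ← mul_assoc,
          mul_comm (ENNReal.ofReal _), ofReal_exp_mul_exp_neg, one_mul]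
    _ = ∫⁻ ν, (∫⁻ y : ℝ, H y ν) ∂Λ := lintegral_lintegral_swap hH.aemeasurable
    _ = ∫⁻ ν, F ν ∂Λ := by
        refine lintegral_congr_ae (hfin.mono fun ν hν => ?_)
        have hI : (fun y => H y ν) = (Set.Ioc ((rightPosition ν).toReal - 1)
            (rightPosition ν).toReal).indicator fun _ => F ν := by
          ext y
          have hiff : ((y : EReal) ≤ rightPosition ν ∧ rightPosition ν < y + 1) ↔
              y ∈ Set.Ioc ((rightPosition ν).toReal - 1) (rightPosition ν).toReal := by
            lift rightPosition ν to ℝ using ⟨hν, rightPosition_ne_bot ν⟩ with r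
            rw [EReal.toReal_coe, Set.mem_Ioc]
            norm_cast
            constructor <;> rintro ⟨h1, h2⟩ <;> constructor <;> linarith
          simp only [H, Set.indicator, Set.mem_ofPred_eq, hiff]
        simp only [hI]
        rw [lintegral_indicator_const measurableSet_Ioc, Real.volume_Ioc]
        simp

/-! ### Superposability in terms of the cumulant -/

/-- The translate `y ↦ f (y + x)` of a test function. -/
def shift (x : ℝ) (f : ℝ → ℝ≥0) : ℝ → ℝ≥0 := fun y => f (y + x)

@[fun_prop]
lemma measurable_shift (x : ℝ) {f : ℝ → ℝ≥0} (hf : Measurable f) : Measurable (shift x f) :=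
  hf.comp (measurable_id.add_const x)

lemma shift_shift (x y : ℝ) (f : ℝ → ℝ≥0) : shift x (shift y f) = shift (x + y) f := by
  ext z; simp [shift, add_assoc]

lemma shift_zero (f : ℝ → ℝ≥0) : shift 0 f = f := by ext; simp [shift]

lemma pairing_star_translate (x : ℝ) (μ : BFMeasureStar) {f : ℝ → ℝ≥0} (hf : Measurable f) :
    pairing (μ.translate x).1.1 f = pairing μ.1.1 (shift x f) := pairing_translate x μ.1 hf

lemma lap_map_translate (ρ : Measure BFMeasure) (x : ℝ) {f : ℝ → ℝ≥0} (hf : Measurable f) :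
    lap (ρ.map (BFMeasure.translate x)) f = lap ρ (shift x f) := by
  rw [lap, lintegral_map (measurable_expNeg_pairing hf) (measurable_translate_const x), lap]
  exact lintegral_congr fun μ => by rw [pairing_translate x μ hf]; rfl

section Superposable
variable {Ω : Type*} [MeasurableSpace Ω] {P : Measure Ω} [IsProbabilityMeasure P]
  {Z : Ω → BFMeasure}

lemma superposable_iff (hZ : Measurable Z) : Superposable P Z ↔
    ∀ α β : ℝ, Real.exp α + Real.exp β = 1 → ∀ f, Measurable f →
      lap (P.map Z) f = lap (P.map Z) (shift α f) * lap (P.map Z) (shift β f) := by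
  have hprob := Measure.isProbabilityMeasure_map (μ := P) hZ.aemeasurable
  have hsum (α β : ℝ) :
      Measurable fun ω : Ω × Ω => ((Z ω.1).translate α).add ((Z ω.2).translate β) :=
    measurable_add.comp (((measurable_translate_const α).comp (hZ.comp measurable_fst)).prodMk
      ((measurable_translate_const β).comp (hZ.comp measurable_snd)))
  have hlap (α β : ℝ) {f : ℝ → ℝ≥0} (hf : Measurable f) :
      lap ((P.prod P).map fun ω : Ω × Ω => ((Z ω.1).translate α).add ((Z ω.2).translate β)) f =
        lap (P.map Z) (shift α f) * lap (P.map Z) (shift β f) := by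
    have h (x : ℝ) : Measurable fun ω => expNeg (pairing (Z ω).1 (shift x f)) :=
      (measurable_expNeg_pairing (measurable_shift x hf)).comp hZ
    rw [lap, lintegral_map (measurable_expNeg_pairing hf) (hsum α β), lap, lap,
      lintegral_map (measurable_expNeg_pairing (measurable_shift α hf)) hZ,
      lintegral_map (measurable_expNeg_pairing (measurable_shift β hf)) hZ,
      ← lintegral_prod_mul (h α).aemeasurable (h β).aemeasurable]
    refine lintegral_congr fun ω => ?_
    change expNeg (pairing (_ + _) f) = _
    rw [pairing_add_measure, expNeg_add, pairing_translate α _ hf, pairing_translate β _ hf]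
    rfl
  constructor
  · intro h α β hαβ f hf
    rw [← hlap α β hf, ← (h α β hαβ).map_eq]
  · intro h α β hαβ
    refine ⟨hZ.aemeasurable, (hsum α β).aemeasurable, ?_⟩
    have := Measure.isProbabilityMeasure_map (μ := P.prod P) (hsum α β).aemeasurable
    refine ext_of_lap fun φ f hf => ?_
    rw [hlap α β hf.measurable, ← h α β hαβ f hf.measurable]

variable {ρ : Measure BFMeasure} [IsProbabilityMeasure ρ]

/-- For s, t > 0, use superposability with e^α = s/(s + t) and e^β = t/(s + t) on f translated by
log(s + t): this is additivity of t ↦ K(f(· + log t)). -/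
lemma logLap_shift (h : ∀ α β : ℝ, Real.exp α + Real.exp β = 1 → ∀ f, Measurable f →
      lap ρ f = lap ρ (shift α f) * lap ρ (shift β f)) (x : ℝ) {f : ℝ → ℝ≥0} (hf : Measurable f) :
    logLap ρ (shift x f) = ENNReal.ofReal (Real.exp x) * logLap ρ f := by
  have h' (α β : ℝ) (hαβ : Real.exp α + Real.exp β = 1) (f) (hf : Measurable f) :
      logLap ρ f = logLap ρ (shift α f) + logLap ρ (shift β f) := by
    rw [← expNeg_inj, expNeg_add, expNeg_logLap, expNeg_logLap, expNeg_logLap, h α β hαβ f hf]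
  -- The value at 0 is set by hand, since `Real.log 0 = 0` would give K(f) there.
  let φ : ℝ≥0 → ℝ≥0∞ := fun t => if t = 0 then 0 else logLap ρ (shift (Real.log t) f)
  have hadd (s t : ℝ≥0) : φ (s + t) = φ s + φ t := by
    rcases eq_or_ne s 0 with rfl | hs
    · simp [φ]
    rcases eq_or_ne t 0 with rfl | ht
    · simp [φ]
    have hst : s + t ≠ 0 := by simp [hs]
    have hs' : (s : ℝ) ≠ 0 := NNReal.coe_ne_zero.2 hs
    have ht' : (t : ℝ) ≠ 0 := NNReal.coe_ne_zero.2 ht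
    have hst' : ((s + t : ℝ≥0) : ℝ) ≠ 0 := NNReal.coe_ne_zero.2 hst
    have hexp {u : ℝ≥0} (hu : u ≠ 0) :
        Real.exp (Real.log u - Real.log (s + t : ℝ≥0)) = u / (s + t : ℝ≥0) := by
      rw [Real.exp_sub, Real.exp_log (NNReal.coe_pos.2 (pos_iff_ne_zero.2 hu)),
        Real.exp_log (NNReal.coe_pos.2 (pos_iff_ne_zero.2 hst))]
    simp only [φ, if_neg hs, if_neg ht, if_neg hst]
    rw [h' (Real.log s - Real.log (s + t : ℝ≥0)) (Real.log t - Real.log (s + t : ℝ≥0)) ?_ _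
      (measurable_shift _ hf), shift_shift, shift_shift, sub_add_cancel, sub_add_cancel]
    rw [hexp hs, hexp ht, ← add_div, ← NNReal.coe_add, div_self hst']
  have hmul := eq_mul_of_additive (φ := φ) (by simp [φ]) hadd (Real.exp x).toNNReal
  have hx : (Real.exp x).toNNReal ≠ 0 := by simp [Real.exp_pos]
  simp only [φ, if_neg hx, if_neg one_ne_zero, NNReal.coe_one, Real.log_one, shift_zero,
    Real.coe_toNNReal _ (Real.exp_pos x).le, Real.log_exp] at hmul
  exact hmul

lemma isInfDiv_of_logLap_shift (h : ∀ (x : ℝ) (f : ℝ → ℝ≥0), Measurable f →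
    logLap ρ (shift x f) = ENNReal.ofReal (Real.exp x) * logLap ρ f) : IsInfDiv ρ := by
  intro n hn
  refine ⟨ρ.map (BFMeasure.translate (-Real.log n)),
    Measure.isProbabilityMeasure_map (measurable_translate_const _).aemeasurable, fun f hf => ?_⟩
  have hn' : (0 : ℝ) < n := by exact_mod_cast hn
  rw [lap_map_translate ρ _ hf, ← expNeg_logLap, h _ f hf, Real.exp_neg, Real.exp_log hn',
    ENNReal.ofReal_inv_of_pos hn', ENNReal.ofReal_natCast, mul_comm, div_eq_mul_inv]

end Superposable

/-! ### Covariance of the drift and of the Lévy measure -/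

section Covariance
variable {l : Measure ℝ} {Λ : Measure BFMeasureStar}

lemma pairing_map_add (l : Measure ℝ) (x : ℝ) {f : ℝ → ℝ≥0} (hf : Measurable f) :
    pairing (l.map fun y => y + x) f = pairing l (shift x f) :=
  lintegral_map hf.coe_nnreal_ennreal (measurable_id.add_const x)

lemma levyForm_map_translate (Λ : Measure BFMeasureStar) (x : ℝ) {f : ℝ → ℝ≥0} (hf : Measurable f) :
    levyForm (Λ.map (BFMeasureStar.translate x)) f = levyForm Λ (shift x f) := by
  rw [levyForm, lintegral_map (measurable_star_one_sub hf) (measurable_star_translate_const x)]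
  simp only [pairing_star_translate x _ hf]
  rfl

/-- By the scaling, the pair e^{-x} T_x l, e^{-x} T_x Λ represents the same functional as l, Λ, so
uniqueness identifies them. -/
lemma map_eq_of_lkForm_shift {h : ℝ → ℝ≥0} (hh : Measurable h) (hpos : ∀ x, 0 < h x)
    (hfin : lkForm l Λ h ≠ ∞)
    (hrep : ∀ f, Measurable f → (∀ μ : BFMeasure, pairing μ.1 f ≠ ∞) → lkForm l Λ f ≠ ∞)
    (hshift : ∀ (x : ℝ) (f : ℝ → ℝ≥0), Measurable f →
      lkForm l Λ (shift x f) = ENNReal.ofReal (Real.exp x) * lkForm l Λ f) (x : ℝ) :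
    Λ.map (BFMeasureStar.translate x) = ENNReal.ofReal (Real.exp x) • Λ ∧
      l.map (fun y => y + x) = ENNReal.ofReal (Real.exp x) • l := by
  set c := ENNReal.ofReal (Real.exp x)
  have hc0 : c ≠ 0 := by simp [c, Real.exp_pos]
  have hc1 : c ≠ ∞ := ENNReal.ofReal_ne_top
  obtain ⟨h1, h2⟩ := lkForm_unique (l' := c⁻¹ • l.map fun y => y + x)
    (Λ' := c⁻¹ • Λ.map (BFMeasureStar.translate x)) hh hpos hfin hrep fun f hf => by
      have e1 : pairing (c⁻¹ • l.map fun y => y + x) f = c⁻¹ * pairing l (shift x f) := by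
        rw [← pairing_map_add l x hf, pairing, lintegral_smul_measure]; rfl
      have e2 : levyForm (c⁻¹ • Λ.map (BFMeasureStar.translate x)) f
          = c⁻¹ * levyForm Λ (shift x f) := by
        rw [← levyForm_map_translate Λ x hf, levyForm, lintegral_smul_measure]; rfl
      rw [lkForm, lkForm, e1, e2, ← mul_add]
      change lkForm l Λ f = c⁻¹ * lkForm l Λ (shift x f)
      rw [hshift x f hf, ← mul_assoc, ENNReal.inv_mul_cancel hc0 hc1, one_mul]
  constructor
  · conv_rhs => rw [h1, smul_smul, ENNReal.mul_inv_cancel hc0 hc1, one_smul]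
  · conv_rhs => rw [h2, smul_smul, ENNReal.mul_inv_cancel hc0 hc1, one_smul]

/-- A locally finite measure with `l (A - x) = e^x l (A)` is a multiple of `e^{-x} dx`. -/
lemma exists_pairing_eq_of_map_add (hl : ∀ A, Bornology.IsBounded A → MeasurableSet A → l A ≠ ∞)
    (h : ∀ x, l.map (fun y => y + x) = ENNReal.ofReal (Real.exp x) • l) :
    ∃ c : ℝ≥0, ∀ f : ℝ → ℝ≥0, Measurable f →
      pairing l f = c * ∫⁻ x : ℝ, ENNReal.ofReal (Real.exp (-x)) * f x := by
  have he : Measurable fun x : ℝ => ENNReal.ofReal (Real.exp x) :=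
    Real.measurable_exp.ennreal_ofReal
  -- The measure e^y l(dy) is translation invariant and locally finite, hence a multiple of Lebesgue
  -- measure.
  let l' : Measure ℝ := l.withDensity fun x => ENNReal.ofReal (Real.exp x)
  have hl' {F : ℝ → ℝ≥0∞} (hF : Measurable F) :
      ∫⁻ y, F y ∂l' = ∫⁻ y, ENNReal.ofReal (Real.exp y) * F y ∂l :=
    lintegral_withDensity_eq_lintegral_mul _ he hF
  have hinv : l'.IsAddLeftInvariant := by
    refine ⟨fun x => Measure.ext_of_lintegral _ fun F hF => ?_⟩
    have hadd : Measurable fun y : ℝ => x + y := measurable_const_add x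
    have e1 : ∫⁻ y, ENNReal.ofReal (Real.exp (y + x)) * F (y + x) ∂l
        = ENNReal.ofReal (Real.exp x) * ∫⁻ y, ENNReal.ofReal (Real.exp y) * F y ∂l := by
      have hm : Measurable fun y => ENNReal.ofReal (Real.exp y) * F y := he.mul hF
      rw [← smul_eq_mul, ← lintegral_smul_measure, ← h x,
        lintegral_map hm (by fun_prop)]
    have hcancel := ofReal_exp_mul_exp_neg x
    rw [lintegral_map hF hadd, hl' (F := fun y => F (x + y)) (hF.comp hadd), hl' hF]
    calc ∫⁻ y, ENNReal.ofReal (Real.exp y) * F (x + y) ∂l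
        = ∫⁻ y, ENNReal.ofReal (Real.exp (-x)) *
            (ENNReal.ofReal (Real.exp (y + x)) * F (y + x)) ∂l := by
          refine lintegral_congr fun y => ?_
          rw [← mul_assoc, ← ENNReal.ofReal_mul (Real.exp_pos _).le, ← Real.exp_add,
            neg_add_cancel_comm_assoc, add_comm x y]
      _ = _ := by
          rw [lintegral_const_mul' _ _ ENNReal.ofReal_ne_top, e1, ← mul_assoc,
            mul_comm (ENNReal.ofReal (Real.exp (-x))), hcancel, one_mul]
  have hfin : IsFiniteMeasureOnCompacts l' := by
    refine ⟨fun K hK => ?_⟩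
    obtain ⟨r, hr⟩ := hK.isBounded.bddAbove
    rw [withDensity_apply _ hK.measurableSet]
    refine (setLIntegral_mono measurable_const
      (g := fun _ => ENNReal.ofReal (Real.exp r)) fun x hx => ?_).trans_lt ?_
    · exact ENNReal.ofReal_le_ofReal (Real.exp_le_exp.2 (hr hx))
    · rw [setLIntegral_const]
      exact ENNReal.mul_lt_top ENNReal.ofReal_lt_top
        (hl K hK.isBounded hK.measurableSet).lt_top
  obtain ⟨c, hc⟩ : ∃ c : ℝ≥0, l' = c • (volume : Measure ℝ) :=
    ⟨_, Measure.isAddLeftInvariant_eq_smul l' volume⟩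
  refine ⟨c, fun f hf => ?_⟩
  have hm : Measurable fun x => ENNReal.ofReal (Real.exp (-x)) * (f x : ℝ≥0∞) :=
    measurable_ofReal_exp_neg.mul hf.coe_nnreal_ennreal
  have h1 : pairing l f = ∫⁻ x, ENNReal.ofReal (Real.exp (-x)) * (f x : ℝ≥0∞) ∂l' := by
    rw [hl' hm, pairing]
    refine lintegral_congr fun x => ?_
    rw [← mul_assoc, ofReal_exp_mul_exp_neg, one_mul]
  rw [h1, hc, lintegral_smul_measure]
  rfl

lemma sFinite_of_levyForm_ne_top {h : ℝ → ℝ≥0} (hh : Measurable h) (hpos : ∀ x, 0 < h x)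
    (hfin : levyForm Λ h ≠ ∞) : SFinite Λ := by
  have hinv := withDensity_inv_same (μ := Λ) (measurable_star_one_sub hh)
    (Eventually.of_forall fun μ => mt one_sub_expNeg_eq_zero.1 (pairing_ne_zero μ.2 hh hpos))
    (Eventually.of_forall fun μ => ENNReal.sub_ne_top ENNReal.one_ne_top)
  have : IsFiniteMeasure (Λ.withDensity fun μ => 1 - expNeg (pairing μ.1.1 h)) :=
    isFiniteMeasure_withDensity hfin
  rw [← hinv]
  infer_instance

/-- By scaling, ∫ (1 - e^{-μ(n, n+1]}) Λ(dμ) is e^{-n} times its value at n = 0. Summing over n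
gives Σ μ(n, n+1] < ∞, that is μ((0, ∞)) < ∞, almost everywhere. -/
lemma ae_rightPosition_ne_top
    (h : ∀ x, Λ.map (BFMeasureStar.translate x) = ENNReal.ofReal (Real.exp x) • Λ)
    (hfin : levyForm Λ ((Set.Ioc (0 : ℝ) 1).indicator fun _ => 1) ≠ ∞) :
    ∀ᵐ μ ∂Λ, rightPosition μ ≠ ⊤ := by
  let u : ℝ → ℝ≥0 := (Set.Ioc (0 : ℝ) 1).indicator fun _ => 1
  have hu : Measurable u := measurable_const.indicator measurableSet_Ioc
  have hun (n : ℕ) : shift (-n) u = (Set.Ioc (n : ℝ) (n + 1)).indicator fun _ => 1 := by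
    ext x
    have : x + -n ∈ Set.Ioc (0 : ℝ) 1 ↔ x ∈ Set.Ioc (n : ℝ) (n + 1) := by
      simp only [Set.mem_Ioc]
      constructor <;> rintro ⟨h1, h2⟩ <;> constructor <;> linarith
    simp only [shift, u, Set.indicator, this]
  have hterm (n : ℕ) : ∫⁻ μ, (1 - expNeg (μ.1.1 (Set.Ioc (n : ℝ) (n + 1)))) ∂Λ
      = ENNReal.ofReal (Real.exp (-n)) * levyForm Λ u := by
    have h1 := levyForm_map_translate Λ (-n) hu
    rw [h, levyForm, lintegral_smul_measure, smul_eq_mul, hun, levyForm] at h1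
    simp only [pairing_indicator _ measurableSet_Ioc, ENNReal.coe_one, one_mul] at h1
    exact h1.symm
  have hmeas (n : ℕ) : Measurable fun μ : BFMeasureStar =>
      1 - expNeg (μ.1.1 (Set.Ioc (n : ℝ) (n + 1))) :=
    (measurable_expNeg.comp ((measurable_eval measurableSet_Ioc).comp
      measurable_subtype_coe)).const_sub _
  have hsum : ∫⁻ μ, ∑' n : ℕ, (1 - expNeg (μ.1.1 (Set.Ioc (n : ℝ) (n + 1)))) ∂Λ ≠ ∞ := by
    rw [lintegral_tsum fun n => (hmeas n).aemeasurable]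
    simp only [hterm]
    rw [ENNReal.tsum_mul_right]
    refine ENNReal.mul_ne_top ?_ hfin
    exact Real.summable_exp_neg_nat.tsum_ofReal_ne_top
  filter_upwards [ae_lt_top (Measurable.tsum hmeas) hsum] with μ hμ
  refine rightPosition_ne_top (ne_top_of_le_ne_top
    (tsum_ne_top_of_one_sub_expNeg (fun n => μ.1.Ioc_ne_top _ _) hμ.ne) ?_)
  refine (measure_mono fun x hx => ?_).trans (measure_iUnion_le _)
  have h0 : 0 < ⌈x⌉₊ := Nat.ceil_pos.2 hx
  refine Set.mem_iUnion.2 ⟨⌈x⌉₊ - 1, ?_, ?_⟩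
  · exact Nat.lt_ceil.1 (by omega)
  · have := Nat.le_ceil x
    have h2 : ((⌈x⌉₊ - 1 : ℕ) : ℝ) + 1 = ⌈x⌉₊ := by exact_mod_cast Nat.sub_add_cancel h0
    rwa [h2]

end Covariance

/-! ### The cumulant form of the theorem -/

section CumulantForm
variable {c : ℝ≥0} {Δ : Measure BFMeasureStar}

/-- The measure `c e^{-x} dx`. -/
def expDrift (c : ℝ≥0) : Measure ℝ :=
  (c : ℝ≥0∞) • (volume : Measure ℝ).withDensity fun x => ENNReal.ofReal (Real.exp (-x))

lemma pairing_expDrift (c : ℝ≥0) {f : ℝ → ℝ≥0} (hf : Measurable f) :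
    pairing (expDrift c) f = c * ∫⁻ x : ℝ, ENNReal.ofReal (Real.exp (-x)) * f x := by
  rw [pairing, expDrift, lintegral_smul_measure, lintegral_withDensity_eq_lintegral_mul _
    measurable_ofReal_exp_neg hf.coe_nnreal_ennreal]
  rfl

lemma cumulantForm_eq (c : ℝ≥0) (Δ : Measure BFMeasureStar) {f : ℝ → ℝ≥0} (hf : Measurable f) :
    cumulantForm c Δ f = pairing (expDrift c) f +
      ∫⁻ x : ℝ, ENNReal.ofReal (Real.exp (-x)) * levyForm Δ (shift x f) := by
  rw [cumulantForm, pairing_expDrift c hf]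
  congr 1
  exact lintegral_congr fun x => by rw [← levyForm_map_translate Δ x hf]; rfl

lemma cumulantForm_eq_lkForm (c : ℝ≥0) (Δ : Measure BFMeasureStar) [SFinite Δ] {f : ℝ → ℝ≥0}
    (hf : Measurable f) : cumulantForm c Δ f = lkForm (expDrift c) (flow Δ) f := by
  rw [cumulantForm_eq c Δ hf, lkForm, levyForm, lintegral_flow Δ (measurable_star_one_sub hf)]
  simp only [pairing_star_translate _ _ hf]
  rfl

lemma cumulantForm_shift (c : ℝ≥0) (Δ : Measure BFMeasureStar) (a : ℝ) {f : ℝ → ℝ≥0}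
    (hf : Measurable f) :
    cumulantForm c Δ (shift a f) = ENNReal.ofReal (Real.exp a) * cumulantForm c Δ f := by
  have key (F : ℝ → ℝ≥0∞) : ∫⁻ x : ℝ, ENNReal.ofReal (Real.exp (-x)) * F (x + a) =
      ENNReal.ofReal (Real.exp a) * ∫⁻ x : ℝ, ENNReal.ofReal (Real.exp (-x)) * F x := by
    rw [← lintegral_add_right_eq_self (fun x => ENNReal.ofReal (Real.exp (-x)) * F x) a,
      ← lintegral_const_mul' _ _ ENNReal.ofReal_ne_top]
    refine lintegral_congr fun x => ?_
    rw [← mul_assoc, ← ENNReal.ofReal_mul (Real.exp_pos _).le, ← Real.exp_add]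
    congr 3
    ring
  rw [cumulantForm_eq c Δ hf, cumulantForm_eq c Δ (measurable_shift a hf),
    pairing_expDrift c hf, pairing_expDrift c (measurable_shift a hf), mul_add]
  congr 1
  · rw [mul_left_comm, ← key fun x => (f x : ℝ≥0∞)]; rfl
  · rw [← key fun x => levyForm Δ (shift x f)]
    simp only [shift_shift]

/-- If Δ were not s-finite, its Lévy form at every translate of h would be infinite, and so would
the integral over x. This supplies the Tonelli hypothesis for an arbitrary competing Δ. -/
lemma sFinite_of_cumulantForm_ne_top {h : ℝ → ℝ≥0} (hh : Measurable h) (hpos : ∀ x, 0 < h x)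
    (hfin : cumulantForm c Δ h ≠ ∞) : SFinite Δ := by
  rw [cumulantForm_eq c Δ hh] at hfin
  have h2 := (ENNReal.add_ne_top.1 hfin).2
  by_contra hns
  refine h2 ?_
  have htop (x : ℝ) : ENNReal.ofReal (Real.exp (-x)) * levyForm Δ (shift x h) = ∞ := by
    have : levyForm Δ (shift x h) = ∞ := by
      by_contra hne
      exact hns (sFinite_of_levyForm_ne_top (measurable_shift x hh) (fun y => hpos _) hne)
    rw [this, ENNReal.mul_top]
    simp [Real.exp_pos]
  simp [htop]

lemma integrabilityCondition_of_cumulantForm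
    (h : ∀ A : Set ℝ, MeasurableSet A → Bornology.IsBounded A →
      cumulantForm c Δ (A.indicator fun _ => 1) ≠ ∞) : IntegrabilityCondition Δ := by
  intro A hA hb
  have hAm : Measurable (A.indicator fun _ => (1 : ℝ≥0)) := measurable_const.indicator hA
  have h1 := h A hA hb
  rw [cumulantForm_eq c Δ hAm] at h1
  refine lt_of_le_of_lt ?_ (ENNReal.add_ne_top.1 h1).2.lt_top
  -- Condition (1) uses A + x with weight e^x, the cumulant form A - x with weight e^{-x}; the
  -- reflection x ↦ -x matches them.
  rw [← lintegral_neg_eq_self]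
  refine lintegral_mono fun x => ?_
  gcongr
  have hB : MeasurableSet ((fun z => z + -x) '' A) :=
    (MeasurableEquiv.addRight (-x)).measurableEmbedding.measurableSet_image.2 hA
  have hind : shift x (A.indicator fun _ => 1) =
      ((fun z => z + -x) '' A).indicator fun _ => (1 : ℝ≥0) := by
    ext z
    have : z + x ∈ A ↔ z ∈ (fun z => z + -x) '' A := by
      rw [Set.image_add_right, neg_neg]; rfl
    by_cases hz : z + x ∈ A
    · rw [Set.indicator_of_mem (this.1 hz), shift, Set.indicator_of_mem hz]
    · rw [Set.indicator_of_notMem (mt this.2 hz), shift, Set.indicator_of_notMem hz]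
  have hev : Measurable fun μ : BFMeasureStar => (μ.1.1 ((fun z => z + -x) '' A)).toReal :=
    ((measurable_eval hB).comp measurable_subtype_coe).ennreal_toReal
  have hBb : Bornology.IsBounded ((fun z => z + -x) '' A) := by
    obtain ⟨r, hr⟩ := isBounded_iff_forall_norm_le.1 hb
    refine isBounded_iff_forall_norm_le.2 ⟨r + ‖-x‖, ?_⟩
    rintro _ ⟨z, hz, rfl⟩
    exact (norm_add_le _ _).trans (add_le_add_left (hr z hz) _)
  rw [setLIntegral_map measurableSet_Ioi (by fun_prop) hev, levyForm, hind]
  refine (setLIntegral_le_lintegral _ _).trans (lintegral_mono fun μ => ?_)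
  rw [pairing_indicator _ hB, ENNReal.coe_one, one_mul, expNeg_of_ne_top (μ.1.2 _ hB hBb).ne,
    ENNReal.ofReal_sub _ (Real.exp_pos _).le, ENNReal.ofReal_one]

end CumulantForm

/-! ### Existence and uniqueness of the representation -/

section Main
variable {Ω : Type*} [MeasurableSpace Ω] {P : Measure Ω} [IsProbabilityMeasure P]
  {Z : Ω → BFMeasure}

lemma hasCumulantForm_iff (hZ : Measurable Z) {c : ℝ≥0} {Δ : Measure BFMeasureStar} :
    HasCumulantForm P Z c Δ ↔ ∀ f, Measurable f → logLap (P.map Z) f = cumulantForm c Δ f := by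
  refine forall₂_congr fun f hf => ?_
  rw [cumulant_eq_logLap P hZ hf, EReal.coe_ennreal_eq_coe_ennreal_iff]

lemma superposable_of_hasCumulantForm (hZ : Measurable Z) {c : ℝ≥0} {Δ : Measure BFMeasureStar}
    (h : HasCumulantForm P Z c Δ) : Superposable P Z := by
  have := Measure.isProbabilityMeasure_map (μ := P) hZ.aemeasurable
  rw [hasCumulantForm_iff hZ] at h
  refine (superposable_iff hZ).2 fun α β hαβ f hf => ?_
  rw [← expNeg_logLap, ← expNeg_logLap, ← expNeg_logLap, ← expNeg_add, h f hf,
    h _ (measurable_shift α hf), h _ (measurable_shift β hf), cumulantForm_shift c Δ α hf,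
    cumulantForm_shift c Δ β hf, ← add_mul, ← ENNReal.ofReal_add (Real.exp_pos _).le
    (Real.exp_pos _).le, hαβ, ENNReal.ofReal_one, one_mul]

lemma logLap_ne_top_of_isBounded (ρ : Measure BFMeasure) [IsProbabilityMeasure ρ] {A : Set ℝ}
    (hA : MeasurableSet A) (hb : Bornology.IsBounded A) :
    logLap ρ (A.indicator fun _ => 1) ≠ ∞ :=
  logLap_ne_top (measurable_const.indicator hA) <| Eventually.of_forall fun μ => by
    rw [pairing_indicator _ hA, ENNReal.coe_one, one_mul]
    exact (μ.2 A hA hb).ne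

lemma exists_hasCumulantForm (hZ : Measurable Z) (h : Superposable P Z) :
    ∃ (c : ℝ≥0) (Δ : Measure BFMeasureStar), Δ {μ | rightPosition μ ≠ 0} = 0 ∧
      IntegrabilityCondition Δ ∧ HasCumulantForm P Z c Δ := by
  have := Measure.isProbabilityMeasure_map (μ := P) hZ.aemeasurable
  set ρ := P.map Z
  have hshift := fun (x : ℝ) (f : ℝ → ℝ≥0) (hf : Measurable f) =>
    logLap_shift ((superposable_iff hZ).1 h) x hf
  obtain ⟨l, Λ, hlk⟩ := exists_lkForm (isInfDiv_of_logLap_shift hshift)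
  obtain ⟨g, hg, hpos, hgfin⟩ := exists_pos_pairing_ne_top ρ
  have hfin : lkForm l Λ g ≠ ∞ := hlk g hg ▸ logLap_ne_top hg hgfin
  have hmap := map_eq_of_lkForm_shift hg hpos hfin
    (fun f hf hf' => hlk f hf ▸ logLap_ne_top hf (Eventually.of_forall hf'))
    (fun x f hf => by rw [← hlk f hf, ← hlk _ (measurable_shift x hf), hshift x f hf])
  have hbdd {A : Set ℝ} (hA : MeasurableSet A) (hb : Bornology.IsBounded A) :
      lkForm l Λ (A.indicator fun _ => 1) ≠ ∞ :=
    hlk _ (measurable_const.indicator hA) ▸ logLap_ne_top_of_isBounded ρ hA hb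
  obtain ⟨c, hc⟩ := exists_pairing_eq_of_map_add (l := l) (fun A hb hA => by
    have := (ENNReal.add_ne_top.1 (hbdd hA hb)).1
    rwa [pairing_indicator _ hA, ENNReal.coe_one, one_mul] at this) fun x => (hmap x).2
  have : SFinite Λ := sFinite_of_levyForm_ne_top hg hpos (ENNReal.add_ne_top.1 hfin).2
  have hflow : flow (unflow Λ) = Λ := by
    refine flow_unflow Λ (fun x F hF => ?_) (ae_rightPosition_ne_top (fun x => (hmap x).1)
      (ENNReal.add_ne_top.1 (hbdd measurableSet_Ioc (Metric.isBounded_Ioc 0 1))).2)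
    rw [← lintegral_map hF (measurable_star_translate_const x), (hmap x).1,
      lintegral_smul_measure, smul_eq_mul]
  have hform (f : ℝ → ℝ≥0) (hf : Measurable f) : logLap ρ f = cumulantForm c (unflow Λ) f := by
    rw [hlk f hf, cumulantForm_eq_lkForm c _ hf, hflow, lkForm, lkForm, hc f hf,
      pairing_expDrift c hf]
  refine ⟨c, unflow Λ, unflow_rightPosition_ne_zero Λ,
    integrabilityCondition_of_cumulantForm (c := c) fun A hA hb => ?_,
    (hasCumulantForm_iff hZ).2 hform⟩
  rw [← hform _ (measurable_const.indicator hA)]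
  exact logLap_ne_top_of_isBounded ρ hA hb

/-- Both pairs give Lévy–Khintchine forms of the same cumulant, so `flow Δ = flow Δ'`, and `unflow`
inverts `flow` on measures carried by {M = 0}. -/
lemma eq_of_hasCumulantForm (hZ : Measurable Z) {c c' : ℝ≥0} {Δ Δ' : Measure BFMeasureStar}
    (hΔ : Δ {μ | rightPosition μ ≠ 0} = 0) (hΔ' : Δ' {μ | rightPosition μ ≠ 0} = 0)
    (h : HasCumulantForm P Z c Δ) (h' : HasCumulantForm P Z c' Δ') : Δ = Δ' := by
  have := Measure.isProbabilityMeasure_map (μ := P) hZ.aemeasurable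
  rw [hasCumulantForm_iff hZ] at h h'
  obtain ⟨g, hg, hpos, hgfin⟩ := exists_pos_pairing_ne_top (P.map Z)
  have hne := logLap_ne_top hg hgfin
  have : SFinite Δ := sFinite_of_cumulantForm_ne_top hg hpos (h g hg ▸ hne)
  have : SFinite Δ' := sFinite_of_cumulantForm_ne_top hg hpos (h' g hg ▸ hne)
  have hlk (f) (hf : Measurable f) : logLap (P.map Z) f = lkForm (expDrift c) (flow Δ) f := by
    rw [h f hf, cumulantForm_eq_lkForm c Δ hf]
  have hflow : flow Δ = flow Δ' :=
    (lkForm_unique (l' := expDrift c') hg hpos (hlk g hg ▸ hne)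
      (fun f hf hf' => hlk f hf ▸ logLap_ne_top hf (Eventually.of_forall hf'))
      fun f hf => by rw [← hlk f hf, h' f hf, cumulantForm_eq_lkForm c' Δ' hf]).1
  rw [← unflow_flow Δ hΔ, hflow, unflow_flow Δ' hΔ']

end Main

end RandomMeasure

end

theorem theorem3p1 {Ω : Type*} [MeasurableSpace Ω] (P : Measure Ω) [IsProbabilityMeasure P]
    (Z : Ω → RandomMeasure.BFMeasure) (hZ : Measurable Z) :
    (RandomMeasure.Superposable P Z ↔
      ∃ (c : ℝ≥0) (Δ : Measure RandomMeasure.BFMeasureStar),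
        RandomMeasure.IntegrabilityCondition Δ ∧ RandomMeasure.HasCumulantForm P Z c Δ) ∧
    (RandomMeasure.Superposable P Z →
      ∃! Δ : Measure RandomMeasure.BFMeasureStar,
        Δ {μ | RandomMeasure.rightPosition μ ≠ 0} = 0 ∧
        RandomMeasure.IntegrabilityCondition Δ ∧
        ∃ c : ℝ≥0, RandomMeasure.HasCumulantForm P Z c Δ) := by
  refine ⟨⟨fun h => ?_, fun ⟨c, Δ, _, h⟩ => RandomMeasure.superposable_of_hasCumulantForm hZ h⟩,
    fun h => ?_⟩
  · obtain ⟨c, Δ, -, h1, h2⟩ := RandomMeasure.exists_hasCumulantForm hZ h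
    exact ⟨c, Δ, h1, h2⟩
  · obtain ⟨c, Δ, h0, h1, h2⟩ := RandomMeasure.exists_hasCumulantForm hZ h
    refine ⟨Δ, ⟨h0, h1, c, h2⟩, ?_⟩
    rintro Δ' ⟨h0', -, c', h2'⟩
    exact RandomMeasure.eq_of_hasCumulantForm hZ h0' h0 h2' h2
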